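/- Let $(p_j)_{j\ge 1}$ be a probability mass function on the positive integers, let $\vec\nu(x)=|\{j: p_j\ge x\}|$ for $x>0$, and let $\ell(x)=\vec\nu(1/x)$ for $x>0$. Assume that $\ell$ belongs to the de Haan class $\Pi_a$, that is, $a:(0,\infty)\to[0,\infty)$ is a measurable function with $$\lim_{\tau\to\infty}\frac{\ell(\tau x)-\ell(\tau)}{a(\tau)}=\log x\qquad\text{for all }x>0$$ (such a function $a$ is automatically slowly varying), and assume that $a(\tau)\to\infty$ as $\tau\to\infty$. Let $U_1,U_2,\dots$ be i.i.d. with $\mathbb P(U_i=j)=p_j$, and let $$M_{n,0}=\sum_{j\ge 1}p_j\,\mathbf 1\{U_i\neq j\text{ for all }1\le i\le n\}$$ be the missing mass of the sample of size $n$. In the Poisson setting let, for each $t\geq 0$, $N(t)$ be a Poisson random variable with expectation $t$, independent of the sequence $(U_i)$, and let $M_0(t)=M_{N(t),0}$. Put $v_n=12\,a(n)/n^2$ and, for real $t>0$, $v_t=12\,a(t)/t^2$. Then: 1. $\operatorname{Var}(M_{n,0})\sim \dfrac{3a(n)}{4n^2}$ as $n\to\infty$, and thus $v_n\asymp\operatorname{Var}(M_{n,0})$.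 2. There exists $n_0\in\mathbb N$, depending only on $(p_j)$ and $a$, such that for all $n>n_0$ and all $\lambda$ with $0<\lambda<n$, $$\log\mathbb E\left[e^{\lambda(M_{n,0}-\mathbb E M_{n,0})}\right]\le\frac{v_n\lambda^2}{2(1-\lambda/n)}.$$ The same results hold in the Poisson setting: $\operatorname{Var}(M_0(t))\sim \dfrac{3a(t)}{4t^2}$ and $v_t\asymp\operatorname{Var}(M_0(t))$ as the real parameter $t\to\infty$, and there exists $t_0\geq 0$, depending only on $(p_j)$ and $a$, such that for all real $t>t_0$ and all $\lambda$ with $0<\lambda<t$, $$\log\mathbb E\left[e^{\lambda(M_0(t)-\mathbb E M_0(t))}\right]\le\frac{v_t\lambda^2}{2(1-\lambda/t)}.$$ -/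

import Mathlib

open MeasureTheory ProbabilityTheory Filter Asymptotics Topology
open scoped NNReal

namespace InfiniteUrn

/-- The counting function of the sampling distribution `p`: the number of symbols `j` whose
probability is at least `x`. For `x > 0` the set is finite; only such `x` matter. -/
noncomputable def counting (p : PMF ℕ) (x : ℝ) : ℝ :=
  (Set.ncard {j : ℕ | x ≤ (p j).toReal} : ℝ)

/-- `ExtendedSlowVariation ℓ a` says that `ℓ`, a nonnegative measurable function on `(0, ∞)`, is in
the de Haan class `Π_a`, with nonnegative measurable auxiliary function `a` on `(0, ∞)`.
Values of `ℓ` and `a` outside `(0, ∞)` are irrelevant. -/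
structure ExtendedSlowVariation (ℓ a : ℝ → ℝ) : Prop where
  measurable_fun : Measurable fun x : Set.Ioi (0 : ℝ) => ℓ x
  nonneg_fun : ∀ x : ℝ, 0 < x → 0 ≤ ℓ x
  measurable_aux : Measurable fun x : Set.Ioi (0 : ℝ) => a x
  nonneg_aux : ∀ x : ℝ, 0 < x → 0 ≤ a x
  tendsto_log : ∀ x : ℝ, 0 < x →
    Tendsto (fun τ : ℝ => (ℓ (τ * x) - ℓ τ) / a τ) atTop (𝓝 (Real.log x))

section Sample

variable {Ω : Type*}

/-- `count U n j ω` is the number of occurrences of the symbol `j` among the first `n` draws. -/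
def count (U : ℕ → Ω → ℕ) (n j : ℕ) (ω : Ω) : ℕ :=
  ((Finset.range n).filter fun i => U i ω = j).card

/-- The total probability `M_{n,r}` of the symbols that occur exactly `r` times in the first `n`
draws. -/
noncomputable def rareMass (p : PMF ℕ) (U : ℕ → Ω → ℕ) (r n : ℕ) (ω : Ω) : ℝ :=
  ∑' j : ℕ, if count U n j ω = r then (p j).toReal else 0

/-- The missing mass `M_{n,0}` (sample of fixed size `n`). -/
noncomputable def missingMass (p : PMF ℕ) (U : ℕ → Ω → ℕ) (n : ℕ) (ω : Ω) : ℝ :=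
  rareMass p U 0 n ω

/-- The missing mass `M_0(t)` in the Poisson setting: the sample size is the random number
`N t`. -/
noncomputable def poissonMissingMass (p : PMF ℕ) (U : ℕ → Ω → ℕ) (N : ℝ≥0 → Ω → ℕ) (t : ℝ≥0)
    (ω : Ω) : ℝ :=
  missingMass p U (N t ω) ω

variable [MeasurableSpace Ω]

/-- The draws `U 0, U 1, …` are independent with common law `p`. -/
structure IsSample (p : PMF ℕ) (P : Measure Ω) (U : ℕ → Ω → ℕ) : Prop where
  indep : iIndepFun U P
  law : ∀ i, HasLaw (U i) p.toMeasure P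

/-- The draws are i.i.d. with law `p` and, for every `t ≥ 0`, the sample size `N t` is Poisson
with expectation `t` and independent of the sequence of draws. -/
structure IsPoissonSample (p : PMF ℕ) (P : Measure Ω) (U : ℕ → Ω → ℕ) (N : ℝ≥0 → Ω → ℕ) :
    Prop where
  sample : IsSample p P U
  law_size : ∀ t, HasLaw (N t) (poissonMeasure t) P
  indep_size : ∀ t, IndepFun (N t) (fun ω i => U i ω) P

/-- The logarithm of the Laplace transform of the centred variable `Z - E Z`, at `lam`. -/
noncomputable def centredLogLaplace (P : Measure Ω) (Z : Ω → ℝ) (lam : ℝ) : ℝ :=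
  Real.log (∫ ω, Real.exp (lam * (Z ω - ∫ ω', Z ω' ∂P)) ∂P)

end Sample

end InfiniteUrn

/-! Everything is governed by the function F(t) = ∑ (t p_j)² exp(-t p_j), `quadExpSum`, and by the
fact that F(t) ~ a(t). Writing x² exp(-x) as the integral of its derivative g gives F(t) = ∫ g(x)
ℓ(t/x) dx. Since ∫ g = 0, ℓ(t) may be subtracted inside; after division by a(t), dominated
convergence with a Potter bound leaves ∫ g(x) log(1/x) dx = 1 (`tendsto_quadExpSum_div`).

Variance: in a Poisson sample the events "j is missing" are independent, so t² Var = F(t) - F(2t)/4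
exactly, which is asymptotic to (1 - 1/4) a(t). For fixed n the covariances and the replacement of
(1 - p_j)^n by exp(-n p_j) cost O((F(n)² + F(n/2)) / n), which is o(a(n)) because F(n) = o(n).

Laplace transform: any finite set of symbols is jointly missing with probability at most that under
independence. Hence the log-Laplace transform is at most ∑ exp(-t p_j) (exp(λ p_j) - 1 - λ p_j).
Expanded in powers of λ/t, its k-th coefficient is the expected number of symbols seen k times in a
Poisson sample. This is at most 6 a(t) uniformly in k ≥ 2 (`exists_sum_poisson_le`), by comparison
with F(2t/k) and Stirling's formula; the geometric series then gives the claim. -/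

namespace InfiniteUrn

/-! ### The counting function -/

section Counting

variable (p : PMF ℕ)

theorem toReal_le_one (j : ℕ) : (p j).toReal ≤ 1 :=
  ENNReal.toReal_mono ENNReal.one_ne_top (p.coe_le_one j)

theorem hasSum_toReal : HasSum (fun j => (p j).toReal) 1 := by
  have h := ENNReal.hasSum_toReal (f := fun j => p j) p.tsum_coe_ne_top
  rwa [← ENNReal.tsum_toReal_eq (fun j => p.apply_ne_top j), p.tsum_coe,
    ENNReal.toReal_one] at h

theorem summable_toReal : Summable fun j => (p j).toReal := (hasSum_toReal p).summable

theorem finite_setOf_le {x : ℝ} (hx : 0 < x) : {j : ℕ | x ≤ (p j).toReal}.Finite := by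
  have h := (summable_toReal p).tendsto_cofinite_zero.eventually (gt_mem_nhds hx)
  simpa [Filter.eventually_cofinite] using h

theorem counting_antitone {x y : ℝ} (hx : 0 < x) (hxy : x ≤ y) :
    counting p y ≤ counting p x := by
  unfold counting
  exact_mod_cast Set.ncard_le_ncard (fun j (hj : y ≤ _) => hxy.trans hj) (finite_setOf_le p hx)

theorem counting_one_div_mono {x y : ℝ} (hx : 0 < x) (hxy : x ≤ y) :
    counting p (1 / x) ≤ counting p (1 / y) :=
  counting_antitone p (by have := hx.trans_le hxy; positivity) (one_div_le_one_div_of_le hx hxy)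

end Counting

/-! ### Slow variation and a Potter bound in de Haan's class -/

section DeHaan

variable {ℓ a : ℝ → ℝ}

/-- The auxiliary function of a function in de Haan's class is slowly varying (at ratio `2`). -/
theorem ExtendedSlowVariation.tendsto_aux_two_mul (h : ExtendedSlowVariation ℓ a)
    (ha : Tendsto a atTop atTop) : Tendsto (fun s => a (2 * s) / a s) atTop (𝓝 1) := by
  have h2 : Tendsto (fun s : ℝ => 2 * s) atTop atTop :=
    tendsto_id.const_mul_atTop (by norm_num)
  have hlog : Real.log 2 ≠ 0 := (Real.log_pos (by norm_num)).ne'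
  have e4 := h.tendsto_log 4 (by norm_num)
  have e2 := h.tendsto_log 2 (by norm_num)
  have e22 := e2.comp h2
  -- The increment from 2s to 4s is measured once against a(s) and once against a(2s); the quotient
  -- of the two is a(2s) / a(s).
  have key := (e4.sub e2).div e22 hlog
  have l4 : Real.log 4 = 2 * Real.log 2 := by
    rw [show (4 : ℝ) = 2 ^ 2 by norm_num, Real.log_pow]; norm_num
  rw [l4, show (2 * Real.log 2 - Real.log 2) / Real.log 2 = 1 by field_simp; ring] at key
  refine key.congr' ?_
  filter_upwards [ha.eventually_gt_atTop 0, h2.eventually (ha.eventually_gt_atTop 0),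
    e22.eventually_ne hlog] with s h0 h02 hne
  simp only [Function.comp, Pi.div_apply] at *
  rw [show 2 * s * 2 = s * 4 by ring, show 2 * s = s * 2 by ring] at *
  have : ℓ (s * 4) - ℓ (s * 2) ≠ 0 := by
    intro h; rw [h] at hne; simp at hne
  field_simp
  ring_nf at this ⊢

theorem ExtendedSlowVariation.tendsto_aux_half (h : ExtendedSlowVariation ℓ a)
    (ha : Tendsto a atTop atTop) : Tendsto (fun s => a (s / 2) / a s) atTop (𝓝 1) := by
  have h2 : Tendsto (fun s : ℝ => s / 2) atTop atTop :=
    tendsto_id.atTop_div_const (by norm_num)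
  have := ((h.tendsto_aux_two_mul ha).comp h2).inv₀ one_ne_zero
  rw [inv_one] at this
  refine this.congr fun s => ?_
  simp [mul_div_cancel₀]

/-- A Potter type bound for monotone functions in de Haan's class. -/
theorem ExtendedSlowVariation.exists_increment_le (h : ExtendedSlowVariation ℓ a)
    (hmono : ∀ x y, 0 < x → x ≤ y → ℓ x ≤ ℓ y) (ha : Tendsto a atTop atTop) :
    ∃ C T : ℝ, 0 < C ∧ 0 < T ∧ ∀ t, T ≤ t → 1 ≤ a t ∧ ∀ x, 0 < x →
      |ℓ (t / x) - ℓ t| ≤ C * (x + 1 / x) * a t := by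
  have hl2 : Real.log 2 < 1 := by
    have := Real.log_two_lt_d9; linarith
  obtain ⟨T, hT⟩ := eventually_atTop.1
    ((eventually_gt_atTop 0).and <| (ha.eventually_ge_atTop 1).and <|
    ((h.tendsto_aux_two_mul ha).eventually (gt_mem_nhds (show (1 : ℝ) < 3 / 2 by norm_num))).and <|
    ((h.tendsto_aux_two_mul ha).eventually (lt_mem_nhds (show (2 / 3 : ℝ) < 1 by norm_num))).and <|
    (h.tendsto_log 2 two_pos).eventually (gt_mem_nhds hl2))
  have T0 : 0 < T := (hT T le_rfl).1
  have a1 : ∀ t, T ≤ t → 1 ≤ a t := fun t ht => (hT t ht).2.1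
  have a2 : ∀ t, T ≤ t → a (2 * t) ≤ 3 / 2 * a t := fun t ht => by
    have := (hT t ht).2.2.1
    rw [div_lt_iff₀ (by linarith [a1 t ht])] at this; exact this.le
  have a3 : ∀ t, T ≤ t → a t ≤ 3 / 2 * a (2 * t) := fun t ht => by
    have := (hT t ht).2.2.2.1
    rw [lt_div_iff₀ (by linarith [a1 t ht])] at this; linarith
  have l2 : ∀ t, T ≤ t → ℓ (2 * t) - ℓ t ≤ a t := fun t ht => by
    have := (hT t ht).2.2.2.2
    rw [div_lt_iff₀ (by linarith [a1 t ht]), mul_comm t] at this; linarith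
  -- The term ℓ(2T) covers descents that leave [T, ∞). The 3 serves the induction: a doubling
  -- changes `a` by a factor at most 3/2, and (3/2)(X + 1) ≤ 2X needs X = D 2^k ≥ 3.
  set D := ℓ (2 * T) + 3 with hD
  have hD3 : 3 ≤ D := by linarith [h.nonneg_fun (2 * T) (by positivity)]
  have up : ∀ k : ℕ, ∀ t y, T ≤ t → 0 < y → y ≤ 2 ^ k * t → ℓ y - ℓ t ≤ D * 2 ^ k * a t := by
    intro k
    induction k with
    | zero =>
      intro t y ht hy hyt
      have := hmono y t hy (by simpa using hyt)
      have := a1 t ht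
      simp only [pow_zero, mul_one]
      nlinarith
    | succ k ih =>
      intro t y ht hy hyt
      have e1 := ih (2 * t) y (by linarith) hy (by rw [pow_succ] at hyt; linarith)
      have e2 := a2 t ht
      have e3 := l2 t ht
      have e4 : (1 : ℝ) ≤ 2 ^ k := one_le_pow₀ (by norm_num)
      have e5 : 3 ≤ D * 2 ^ k := by nlinarith
      have e6 := a1 t ht
      have e7 : D * 2 ^ k * a (2 * t) ≤ D * 2 ^ k * (3 / 2 * a t) := by gcongr
      rw [pow_succ]
      nlinarith
  have down : ∀ k : ℕ, ∀ t y, T ≤ t → 0 < y → t ≤ 2 ^ k * y → ℓ t - ℓ y ≤ D * 2 ^ k * a t := by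
    intro k
    induction k with
    | zero =>
      intro t y ht hy hyt
      have := hmono t y (by linarith) (by simpa using hyt)
      have := a1 t ht
      simp only [pow_zero, mul_one]
      nlinarith
    | succ k ih =>
      intro t y ht hy hyt
      have e4 : (1 : ℝ) ≤ 2 ^ k := one_le_pow₀ (by norm_num)
      have e5 : D ≤ D * 2 ^ k := by nlinarith
      have e6 := a1 t ht
      rw [pow_succ]
      rcases le_or_gt T (t / 2) with h2 | h2
      · have e1 := ih (t / 2) y h2 hy (by rw [pow_succ] at hyt; linarith)
        have e2 := a3 _ h2
        have e3 := l2 _ h2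
        rw [mul_div_cancel₀ _ (two_ne_zero)] at e2 e3
        have e7 : D * 2 ^ k * a (t / 2) ≤ D * 2 ^ k * (3 / 2 * a t) := by gcongr
        nlinarith
      · have e1 := hmono t (2 * T) (by linarith) (by linarith)
        have e2 := h.nonneg_fun y hy
        nlinarith
  refine ⟨2 * D, T, by linarith, T0, fun t ht => ⟨a1 t ht, fun x hx => ?_⟩⟩
  have t0 : 0 < t := by linarith
  have at1 := a1 t ht
  rcases le_total 1 x with h1 | h1
  · obtain ⟨k, hk1, hk2⟩ := exists_nat_pow_near h1 (show (1 : ℝ) < 2 by norm_num)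
    have e1 := down (k + 1) t (t / x) ht (by positivity) (by
      rw [mul_div_assoc', le_div_iff₀ hx, mul_comm]; gcongr)
    have e2 := hmono (t / x) t (by positivity) (div_le_self t0.le h1)
    rw [abs_sub_comm, abs_of_nonneg (by linarith)]
    refine e1.trans ?_
    have : 0 < 1 / x := by positivity
    have : (2 : ℝ) ^ (k + 1) ≤ 2 * (x + 1 / x) := by rw [pow_succ]; linarith
    calc D * 2 ^ (k + 1) * a t ≤ D * (2 * (x + 1 / x)) * a t := by gcongr
      _ = _ := by ring
  · obtain ⟨k, hk1, hk2⟩ := exists_nat_pow_near ((one_le_div hx).2 h1)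
      (show (1 : ℝ) < 2 by norm_num)
    have e1 := up (k + 1) t (t / x) ht (by positivity) (by
      rw [div_eq_mul_one_div, mul_comm]; gcongr)
    have e2 := hmono t (t / x) (by positivity) (by rw [le_div_iff₀ hx]; nlinarith)
    rw [abs_of_nonneg (by linarith)]
    refine e1.trans ?_
    have : (2 : ℝ) ^ (k + 1) ≤ 2 * (x + 1 / x) := by rw [pow_succ]; linarith
    calc D * 2 ^ (k + 1) * a t ≤ D * (2 * (x + 1 / x)) * a t := by gcongr
      _ = _ := by ring

end DeHaan

/-! ### The kernel (x² exp(-x))' and its integrals -/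

section Kernel

theorem mul_exp_neg_le_one (x : ℝ) : x * Real.exp (-x) ≤ 1 := by
  have h := Real.add_one_le_exp x
  calc x * Real.exp (-x) ≤ Real.exp x * Real.exp (-x) := by gcongr; linarith
    _ = 1 := by rw [← Real.exp_add]; simp

theorem integrableOn_pow_mul_exp_neg (n : ℕ) :
    IntegrableOn (fun x : ℝ => x ^ n * Real.exp (-x)) (Set.Ioi 0) := by
  have h := Real.GammaIntegral_convergent (s := n + 1) (by positivity)
  refine h.congr_fun (fun x hx => ?_) measurableSet_Ioi
  simp [mul_comm]

theorem hasDerivAt_sq_mul_exp_neg (x : ℝ) :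
    HasDerivAt (fun x : ℝ => x ^ 2 * Real.exp (-x)) ((2 * x - x ^ 2) * Real.exp (-x)) x := by
  have := (hasDerivAt_pow 2 x).mul (hasDerivAt_neg x).exp
  refine this.congr_deriv ?_
  simp; ring

theorem continuous_sq_mul_exp_neg_deriv :
    Continuous fun x : ℝ => (2 * x - x ^ 2) * Real.exp (-x) := by fun_prop

theorem integrableOn_sq_mul_exp_neg_deriv :
    IntegrableOn (fun x : ℝ => (2 * x - x ^ 2) * Real.exp (-x)) (Set.Ioi 0) := by
  have := ((integrableOn_pow_mul_exp_neg 1).const_mul 2).sub (integrableOn_pow_mul_exp_neg 2)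
  refine this.congr (Eventually.of_forall fun x => ?_)
  simp; ring

theorem integral_sq_mul_exp_neg_deriv :
    ∫ x in Set.Ioi (0 : ℝ), (2 * x - x ^ 2) * Real.exp (-x) = 0 := by
  rw [integral_Ioi_of_hasDerivAt_of_tendsto' (fun x _ => hasDerivAt_sq_mul_exp_neg x)
    integrableOn_sq_mul_exp_neg_deriv (Real.tendsto_pow_mul_exp_neg_atTop_nhds_zero 2)]
  simp

/-- The dominating function for the limit of F(t) / a(t): the factor x of 2x - x² cancels the
singularity 1/x of the Potter bound. -/
theorem integrableOn_dominating :
    IntegrableOn (fun x : ℝ => |(2 * x - x ^ 2) * Real.exp (-x)| * (x + 1 / x)) (Set.Ioi 0) := by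
  have h : IntegrableOn (fun x : ℝ => (x ^ 3 * Real.exp (-x) + 2 * (x ^ 2 * Real.exp (-x))) +
      (x ^ 1 * Real.exp (-x) + 2 * (x ^ 0 * Real.exp (-x)))) (Set.Ioi 0) :=
    ((integrableOn_pow_mul_exp_neg 3).add ((integrableOn_pow_mul_exp_neg 2).const_mul 2)).add
    ((integrableOn_pow_mul_exp_neg 1).add ((integrableOn_pow_mul_exp_neg 0).const_mul 2))
  refine Integrable.mono' h ?_ ?_
  · exact (Measurable.aestronglyMeasurable (by fun_prop))
  · refine (ae_restrict_iff' measurableSet_Ioi).2 (Eventually.of_forall fun x (hx : 0 < x) => ?_)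
    rw [Real.norm_of_nonneg (by positivity), abs_mul, Real.abs_exp]
    have : |2 * x - x ^ 2| ≤ x * (2 + x) := by rw [abs_le]; constructor <;> nlinarith
    calc _ ≤ x * (2 + x) * Real.exp (-x) * (x + 1 / x) := by gcongr
      _ = _ := by field_simp; ring

theorem abs_log_le_add_one_div {x : ℝ} (hx : 0 < x) : |Real.log x| ≤ x + 1 / x := by
  have h1 := Real.log_le_self hx.le
  have h2 := Real.log_le_self (inv_pos.2 hx).le
  rw [Real.log_inv] at h2
  rw [one_div, abs_le]
  have : 0 < x⁻¹ := by positivity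
  constructor <;> linarith

/-- Integration by parts turns the integral into ∫ x exp(-x) dx = Γ(2). The antiderivative is
written with the factor x log x, which is continuous at 0. -/
theorem integral_sq_mul_exp_neg_deriv_mul_log :
    ∫ x in Set.Ioi (0 : ℝ), (2 * x - x ^ 2) * Real.exp (-x) * Real.log (1 / x) = 1 := by
  have hI : IntegrableOn
      (fun x : ℝ => (2 * x - x ^ 2) * Real.exp (-x) * Real.log (1 / x)) (Set.Ioi 0) := by
    refine Integrable.mono' integrableOn_dominating
      (Measurable.aestronglyMeasurable (by fun_prop)) ?_
    refine (ae_restrict_iff' measurableSet_Ioi).2 (Eventually.of_forall fun x (hx : 0 < x) => ?_)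
    rw [norm_mul, Real.norm_eq_abs, Real.norm_eq_abs, one_div, Real.log_inv, abs_neg, ← one_div]
    gcongr
    exact abs_log_le_add_one_div hx
  have hD : ∀ x ∈ Set.Ioi (0 : ℝ), HasDerivAt
      (fun x : ℝ => -(x * Real.exp (-x) * (x * Real.log x)) - (x + 1) * Real.exp (-x))
      ((2 * x - x ^ 2) * Real.exp (-x) * Real.log (1 / x)) x := by
    intro x hx
    have hx0 : x ≠ 0 := (Set.mem_Ioi.1 hx).ne'
    have e := (hasDerivAt_neg x).exp
    have h := ((((hasDerivAt_id x).mul e).mul ((hasDerivAt_id x).mul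
      (Real.hasDerivAt_log hx0))).neg).sub (((hasDerivAt_id x).add_const 1).mul e)
    refine h.congr_deriv ?_
    rw [one_div, Real.log_inv]
    simp only [id, Pi.mul_apply]
    field_simp
    ring
  have hT : Tendsto
      (fun x : ℝ => -(x * Real.exp (-x) * (x * Real.log x)) - (x + 1) * Real.exp (-x))
      atTop (𝓝 0) := by
    have p3 := Real.tendsto_pow_mul_exp_neg_atTop_nhds_zero 3
    have p1 := Real.tendsto_pow_mul_exp_neg_atTop_nhds_zero 1
    have p0 := Real.tendsto_pow_mul_exp_neg_atTop_nhds_zero 0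
    have a1 : Tendsto (fun x : ℝ => x * Real.exp (-x) * (x * Real.log x)) atTop (𝓝 0) := by
      refine squeeze_zero' ?_ ?_ p3
      · filter_upwards [eventually_ge_atTop 1] with x hx
        have := Real.log_nonneg hx
        positivity
      · filter_upwards [eventually_ge_atTop 1] with x hx
        have := Real.log_le_self (zero_le_one.trans hx)
        calc x * Real.exp (-x) * (x * Real.log x) ≤ x * Real.exp (-x) * (x * x) := by gcongr
          _ = _ := by ring
    have := a1.neg.sub (p1.add p0)
    simp only [neg_zero, add_zero, sub_zero] at this
    refine this.congr fun x => ?_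
    ring
  rw [integral_Ioi_of_hasDerivAt_of_tendsto ?_ hD hI hT]
  · simp
  · refine Continuous.continuousWithinAt ?_
    have := Real.continuous_mul_log
    fun_prop

end Kernel

/-! ### The function F and its equivalence with a -/

section QuadExpSum

variable (p : PMF ℕ)

/-- The sum of `x ^ 2 * exp (-x)` over the points `x = t * p j`. -/
noncomputable def quadExpSum (t : ℝ) : ℝ :=
  ∑' j, (t * (p j).toReal) ^ 2 * Real.exp (-(t * (p j).toReal))

theorem sq_mul_exp_neg_le {x : ℝ} (hx : 0 ≤ x) : x ^ 2 * Real.exp (-x) ≤ x := by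
  have := mul_exp_neg_le_one x
  nlinarith

theorem summable_quadExp {t : ℝ} (ht : 0 ≤ t) :
    Summable fun j => (t * (p j).toReal) ^ 2 * Real.exp (-(t * (p j).toReal)) :=
  Summable.of_nonneg_of_le (fun j => by positivity)
    (fun j => sq_mul_exp_neg_le (by positivity)) ((summable_toReal p).mul_left t)

theorem quadExpSum_nonneg (t : ℝ) : 0 ≤ quadExpSum p t := tsum_nonneg fun j => by positivity

theorem quadExpSum_le {t : ℝ} (ht : 0 ≤ t) : quadExpSum p t ≤ t := by
  have h := (summable_quadExp p ht).tsum_le_tsum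
    (fun j => sq_mul_exp_neg_le (mul_nonneg ht ENNReal.toReal_nonneg))
    ((summable_toReal p).mul_left t)
  rwa [tsum_mul_left, (hasSum_toReal p).tsum_eq, mul_one] at h

theorem tsum_ite_le_eq_mul_counting (c : ℝ) {t x : ℝ} (ht : 0 < t) (hx : 0 < x) :
    ∑' j, (if x ≤ t * (p j).toReal then c else 0) = c * counting p (1 / (t / x)) := by
  have hfin := finite_setOf_le p (div_pos hx ht)
  rw [tsum_eq_sum (s := hfin.toFinset)]
  · rw [one_div_div, counting, Set.ncard_eq_toFinset_card _ hfin, mul_comm, ← nsmul_eq_mul,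
      ← Finset.sum_const]
    refine Finset.sum_congr rfl fun j hj => if_pos ?_
    simp only [Set.Finite.mem_toFinset, Set.mem_ofPred_eq, div_le_iff₀ ht] at hj
    linarith
  · intro j hj
    simp only [Set.Finite.mem_toFinset, Set.mem_ofPred_eq, div_le_iff₀ ht] at hj
    refine if_neg fun h => hj (by linarith)

/-- Layer-cake formula: each term is the integral of the kernel over (0, t p_j]. Sum and integral
may be exchanged because the kernel is bounded by 4 and ∑ t p_j = t. -/
theorem quadExpSum_eq_integral {t : ℝ} (ht : 0 < t) :
    quadExpSum p t = ∫ x in Set.Ioi (0 : ℝ),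
      (2 * x - x ^ 2) * Real.exp (-x) * counting p (1 / (t / x)) := by
  set g : ℝ → ℝ := fun x => (2 * x - x ^ 2) * Real.exp (-x) with hg
  have hgc : Continuous g := continuous_sq_mul_exp_neg_deriv
  set b : ℕ → ℝ := fun j => t * (p j).toReal with hb
  have hb0 : ∀ j, 0 ≤ b j := fun j => by positivity
  have hF : ∀ j, (fun x => if x ≤ b j then g x else 0) = (Set.Iic (b j)).indicator g := by
    intro j; ext x; simp [Set.indicator_apply]
  have hset : ∀ j, Set.Iic (b j) ∩ Set.Ioi 0 = Set.Ioc 0 (b j) := by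
    intro j; ext x; simp [and_comm]
  have h1 : ∀ j, Integrable (fun x => if x ≤ b j then g x else 0)
      (volume.restrict (Set.Ioi 0)) := fun j => by
    rw [hF]; exact (integrableOn_sq_mul_exp_neg_deriv.integrable).indicator measurableSet_Iic
  have h2 : ∀ j, ∫ x in Set.Ioi 0, (if x ≤ b j then g x else 0) =
      (b j) ^ 2 * Real.exp (-(b j)) := by
    intro j
    rw [hF, integral_indicator measurableSet_Iic, Measure.restrict_restrict measurableSet_Iic,
      hset, ← intervalIntegral.integral_of_le (hb0 j),
      intervalIntegral.integral_eq_sub_of_hasDerivAt (fun x _ => hasDerivAt_sq_mul_exp_neg x)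
        (hgc.intervalIntegrable _ _)]
    simp
  have hgb : ∀ x, 0 ≤ x → ‖g x‖ ≤ 4 := by
    intro x hx
    have e1 := mul_exp_neg_le_one x
    have e2 := mul_exp_neg_le_one (x / 2)
    have e3 : Real.exp (-x) = Real.exp (-(x / 2)) ^ 2 := by
      rw [← Real.exp_nat_mul]; congr 1; push_cast; ring
    have e4 : 0 ≤ x / 2 * Real.exp (-(x / 2)) := by positivity
    have e6 : x ^ 2 * Real.exp (-x) ≤ 4 := by rw [e3]; nlinarith
    have e7 : 0 ≤ x ^ 2 * Real.exp (-x) := by positivity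
    have e8 : 0 ≤ x * Real.exp (-x) := by positivity
    have e5 : g x = 2 * (x * Real.exp (-x)) - x ^ 2 * Real.exp (-x) := by simp only [hg]; ring
    rw [Real.norm_eq_abs, e5, abs_le]
    constructor <;> linarith
  have h3 : ∀ j, ∫ x in Set.Ioi 0, ‖if x ≤ b j then g x else 0‖ ≤ 4 * b j := by
    intro j
    have : (fun x => ‖if x ≤ b j then g x else 0‖) =
        (Set.Iic (b j)).indicator fun x => ‖g x‖ := by
      ext x; by_cases h : x ≤ b j <;> simp [h]
    rw [this, integral_indicator measurableSet_Iic, Measure.restrict_restrict measurableSet_Iic,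
      hset, ← intervalIntegral.integral_of_le (hb0 j)]
    have h := intervalIntegral.norm_integral_le_of_norm_le_const (a := 0) (b := b j) (C := 4)
      (f := fun x => ‖g x‖) (fun x hx => by
        rw [norm_norm]; rw [Set.uIoc_of_le (hb0 j)] at hx; exact hgb x hx.1.le)
    rw [sub_zero, abs_of_nonneg (hb0 j)] at h
    exact (le_abs_self _).trans h
  have h4 : Summable fun j => ∫ x in Set.Ioi 0, ‖if x ≤ b j then g x else 0‖ :=
    Summable.of_nonneg_of_le (fun j => integral_nonneg fun x => norm_nonneg _) h3
      (((summable_toReal p).mul_left t).mul_left 4)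
  have h5 := hasSum_integral_of_summable_integral_norm h1 h4
  simp only [h2] at h5
  rw [quadExpSum, h5.tsum_eq]
  refine setIntegral_congr_fun measurableSet_Ioi fun x hx => ?_
  exact tsum_ite_le_eq_mul_counting p (g x) ht hx

variable {p} {a : ℝ → ℝ}

theorem tendsto_quadExpSum_div
    (h : ExtendedSlowVariation (fun x : ℝ => counting p (1 / x)) a)
    (ha : Tendsto a atTop atTop) : Tendsto (fun t => quadExpSum p t / a t) atTop (𝓝 1) := by
  obtain ⟨C, T, hC, hT, hb⟩ := h.exists_increment_le
    (fun x y hx hxy => counting_one_div_mono p hx hxy) ha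
  set g : ℝ → ℝ := fun x => (2 * x - x ^ 2) * Real.exp (-x) with hg
  have hm : ∀ t, 0 < t → AEMeasurable (fun x => counting p (1 / (t / x)))
      (volume.restrict (Set.Ioi 0)) := fun t ht =>
    aemeasurable_restrict_of_antitoneOn measurableSet_Ioi fun x hx y hy hxy =>
      counting_one_div_mono p (div_pos ht hy) (div_le_div_of_nonneg_left ht.le hx hxy)
  have hgm : AEMeasurable g (volume.restrict (Set.Ioi 0)) :=
    continuous_sq_mul_exp_neg_deriv.measurable.aemeasurable
  have hbound : ∀ t, T ≤ t → ∀ x, 0 < x →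
      ‖g x * ((counting p (1 / (t / x)) - counting p (1 / t)) / a t)‖ ≤
        C * (|g x| * (x + 1 / x)) := by
    intro t ht x hx
    obtain ⟨h1, h2⟩ := hb t ht
    have a0 : 0 < a t := by linarith
    have : |(counting p (1 / (t / x)) - counting p (1 / t)) / a t| ≤ C * (x + 1 / x) := by
      rw [abs_div, abs_of_pos a0, div_le_iff₀ a0]; exact h2 x hx
    rw [norm_mul, Real.norm_eq_abs, Real.norm_eq_abs]
    calc _ ≤ |g x| * (C * (x + 1 / x)) := by gcongr
      _ = _ := by ring
  have hlim : Tendsto (fun t => ∫ x in Set.Ioi (0 : ℝ),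
      g x * ((counting p (1 / (t / x)) - counting p (1 / t)) / a t)) atTop
      (𝓝 (∫ x in Set.Ioi (0 : ℝ), g x * Real.log (1 / x))) := by
    refine tendsto_integral_filter_of_dominated_convergence
      (fun x => C * (|g x| * (x + 1 / x))) ?_ ?_ (integrableOn_dominating.const_mul C) ?_
    · filter_upwards [eventually_gt_atTop 0] with t ht
      exact (hgm.mul (((hm t ht).sub_const _).div_const _)).aestronglyMeasurable
    · filter_upwards [eventually_ge_atTop T] with t ht
      exact (ae_restrict_iff' measurableSet_Ioi).2 (Eventually.of_forall fun x hx =>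
        hbound t ht x hx)
    · refine (ae_restrict_iff' measurableSet_Ioi).2 (Eventually.of_forall fun x hx => ?_)
      refine Tendsto.const_mul _ ?_
      have := h.tendsto_log (1 / x) (one_div_pos.2 hx)
      simpa only [mul_one_div] using this
  rw [integral_sq_mul_exp_neg_deriv_mul_log] at hlim
  refine hlim.congr' ?_
  filter_upwards [eventually_ge_atTop T] with t ht
  have t0 : 0 < t := hT.trans_le ht
  have a0 : a t ≠ 0 := by linarith [(hb t ht).1]
  have i1 : Integrable (fun x => g x * ((counting p (1 / (t / x)) - counting p (1 / t)) / a t))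
      (volume.restrict (Set.Ioi 0)) :=
    Integrable.mono' (integrableOn_dominating.const_mul C)
      (hgm.mul (((hm t t0).sub_const _).div_const _)).aestronglyMeasurable
      ((ae_restrict_iff' measurableSet_Ioi).2 (Eventually.of_forall fun x hx =>
        hbound t ht x hx))
  have i2 : Integrable (fun x => counting p (1 / t) / a t * g x)
      (volume.restrict (Set.Ioi 0)) := integrableOn_sq_mul_exp_neg_deriv.const_mul _
  -- The kernel has integral 0, so the subtracted constant ℓ(t) can be put back at no cost.
  have i3 := integral_add i1 i2
  rw [integral_const_mul, integral_sq_mul_exp_neg_deriv, mul_zero, add_zero] at i3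
  rw [← i3, quadExpSum_eq_integral p t0, ← integral_div]
  refine integral_congr_ae (Eventually.of_forall fun x => ?_)
  simp only [hg]
  field_simp
  ring

end QuadExpSum

/-! ### Bounds on F and on Poisson occupancy counts -/

section Asymptotics

variable (p : PMF ℕ)

/-- Dominated convergence for series: the terms p_j · (t p_j exp(-t p_j)) are at most p_j and tend
to 0. -/
theorem tendsto_quadExpSum_div_self :
    Tendsto (fun t => quadExpSum p t / t) atTop (𝓝 0) := by
  have h : Tendsto (fun t : ℝ => ∑' j, (p j).toReal * (t * (p j).toReal *
      Real.exp (-(t * (p j).toReal)))) atTop (𝓝 (∑' _ : ℕ, (0 : ℝ))) := by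
    refine tendsto_tsum_of_dominated_convergence (summable_toReal p) (fun j => ?_) ?_
    · rcases eq_or_lt_of_le (ENNReal.toReal_nonneg (a := p j)) with h0 | h0
      · simp [← h0]
      · have e := (Real.tendsto_pow_mul_exp_neg_atTop_nhds_zero 1).comp
          (tendsto_id.atTop_mul_const h0)
        simpa [Function.comp_def] using e.const_mul (p j).toReal
    · filter_upwards [eventually_ge_atTop 0] with t ht j
      rw [Real.norm_of_nonneg (by positivity)]
      exact mul_le_of_le_one_right ENNReal.toReal_nonneg (mul_exp_neg_le_one _)
  rw [tsum_zero] at h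
  refine h.congr' ?_
  filter_upwards [eventually_gt_atTop 0] with t ht
  rw [quadExpSum, ← tsum_div_const]
  congr 1; ext j
  field_simp

theorem quadExpSum_le_four_mul {s w : ℝ} (hw : 0 ≤ w) (h1 : w ≤ s) (h2 : s ≤ 2 * w) :
    quadExpSum p s ≤ 4 * quadExpSum p w := by
  rw [quadExpSum, quadExpSum, ← tsum_mul_left]
  refine (summable_quadExp p (hw.trans h1)).tsum_le_tsum (fun j => ?_)
    ((summable_quadExp p hw).mul_left 4)
  have hj : 0 ≤ (p j).toReal := ENNReal.toReal_nonneg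
  calc (s * (p j).toReal) ^ 2 * Real.exp (-(s * (p j).toReal))
      ≤ (2 * w * (p j).toReal) ^ 2 * Real.exp (-(w * (p j).toReal)) := by
        gcongr
        exact mul_nonneg (hw.trans h1) hj
    _ = _ := by ring

variable {p} {a : ℝ → ℝ}

theorem tendsto_quadExpSum_half_div
    (h : ExtendedSlowVariation (fun x : ℝ => counting p (1 / x)) a)
    (ha : Tendsto a atTop atTop) : Tendsto (fun t => quadExpSum p (t / 2) / a t) atTop (𝓝 1) := by
  have h2 : Tendsto (fun s : ℝ => s / 2) atTop atTop :=
    tendsto_id.atTop_div_const (by norm_num)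
  have e := ((tendsto_quadExpSum_div h ha).comp h2).mul (h.tendsto_aux_half ha)
  rw [mul_one] at e
  refine e.congr' ?_
  filter_upwards [(ha.comp h2).eventually_gt_atTop 0] with t h0
  simp only [Function.comp] at *
  field_simp

theorem tendsto_quadExpSum_two_mul_div
    (h : ExtendedSlowVariation (fun x : ℝ => counting p (1 / x)) a)
    (ha : Tendsto a atTop atTop) : Tendsto (fun t => quadExpSum p (2 * t) / a t) atTop (𝓝 1) := by
  have h2 : Tendsto (fun s : ℝ => 2 * s) atTop atTop :=
    tendsto_id.const_mul_atTop (by norm_num)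
  have e := ((tendsto_quadExpSum_div h ha).comp h2).mul (h.tendsto_aux_two_mul ha)
  rw [mul_one] at e
  refine e.congr' ?_
  filter_upwards [(ha.comp h2).eventually_gt_atTop 0] with t h0
  simp only [Function.comp] at *
  field_simp

/-- A Potter type bound for `quadExpSum`, valid down to small arguments. -/
theorem exists_quadExpSum_div_le
    (h : ExtendedSlowVariation (fun x : ℝ => counting p (1 / x)) a)
    (ha : Tendsto a atTop atTop) :
    ∃ T : ℝ, 0 < T ∧ ∀ t, T ≤ t → 0 < a t ∧ ∀ m : ℝ, 1 ≤ m →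
      quadExpSum p (t / m) ≤ 8 * √m * a t := by
  obtain ⟨T, hT⟩ := eventually_atTop.1
    ((eventually_gt_atTop 0).and <| (ha.eventually_gt_atTop 0).and <|
    ((tendsto_quadExpSum_div h ha).eventually
      (gt_mem_nhds (show (1 : ℝ) < 11 / 10 by norm_num))).and <|
    ((tendsto_quadExpSum_div h ha).eventually
      (lt_mem_nhds (show (9 / 10 : ℝ) < 1 by norm_num))).and <|
    (tendsto_quadExpSum_half_div h ha).eventually
      (gt_mem_nhds (show (1 : ℝ) < 11 / 10 by norm_num)))
  have T0 : 0 < T := (hT T le_rfl).1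
  have a0 : ∀ t, T ≤ t → 0 < a t := fun t ht => (hT t ht).2.1
  have hF : ∀ t, T ≤ t → quadExpSum p t ≤ 11 / 10 * a t := fun t ht =>
    ((div_lt_iff₀ (a0 t ht)).1 (hT t ht).2.2.1).le
  -- Any ratio below √2 would do: (7/5)² ≤ 2 makes j halvings cost at most √(2^j) ≤ √m.
  have hhalf : ∀ t, T ≤ t → quadExpSum p (t / 2) ≤ 7 / 5 * quadExpSum p t := fun t ht => by
    have e1 := (lt_div_iff₀ (a0 t ht)).1 (hT t ht).2.2.2.1
    have e2 := (div_lt_iff₀ (a0 t ht)).1 (hT t ht).2.2.2.2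
    linarith [a0 t ht]
  have iter : ∀ j : ℕ, ∀ t, T ≤ t / 2 ^ j →
      quadExpSum p (t / 2 ^ (j + 1)) ≤ (7 / 5) ^ (j + 1) * quadExpSum p t := by
    intro j
    induction j with
    | zero => intro t ht; simpa using hhalf t (by simpa using ht)
    | succ j ih =>
      intro t ht
      have t0 : 0 < t / 2 ^ (j + 1) := T0.trans_le ht
      have e1 := hhalf _ ht
      have e2 := ih t (ht.trans (by
        rw [pow_succ, ← div_div]; rw [pow_succ, ← div_div] at t0; linarith))
      rw [div_div, ← pow_succ] at e1
      rw [pow_succ (7 / 5 : ℝ)]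
      linarith
  obtain ⟨T', hT'⟩ := eventually_atTop.1 (ha.eventually_ge_atTop T)
  refine ⟨max T T', lt_max_of_lt_left T0, fun t ht => ?_⟩
  have tT := (le_max_left _ _).trans ht
  have t0 := T0.trans_le tT
  have at0 := a0 t tT
  refine ⟨at0, fun m hm => ?_⟩
  obtain ⟨j, hj1, hj2⟩ := exists_nat_pow_near hm (show (1 : ℝ) < 2 by norm_num)
  have m0 : 0 < m := by linarith
  have hsq1 : 1 ≤ √m := Real.one_le_sqrt.2 hm
  -- Halving is controlled only above T. Below it, the trivial F(s) ≤ s gives F(t/m) ≤ T ≤ a(t),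
  -- since a tends to infinity.
  rcases le_or_gt T (t / 2 ^ j) with hc | hc
  · have e1 := iter j t hc
    have e2 : quadExpSum p (t / m) ≤ 4 * quadExpSum p (t / 2 ^ (j + 1)) := by
      refine quadExpSum_le_four_mul p (by positivity) ?_ ?_
      · exact div_le_div_of_nonneg_left t0.le m0 hj2.le
      · rw [pow_succ, ← div_div, mul_div_cancel₀ _ two_ne_zero]
        exact div_le_div_of_nonneg_left t0.le (by positivity) hj1
    have e3 : (7 / 5 : ℝ) ^ j ≤ √m := by
      refine Real.le_sqrt_of_sq_le ?_
      rw [← pow_mul, mul_comm, pow_mul]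
      exact le_trans (pow_le_pow_left₀ (by norm_num) (by norm_num) _) hj1
    have e4 := hF t tT
    have e5 : (7 / 5 : ℝ) ^ (j + 1) * quadExpSum p t ≤ √m * (7 / 5) * (11 / 10 * a t) := by
      rw [pow_succ]; gcongr
      exact quadExpSum_nonneg p t
    have e6 : 0 < √m * a t := by positivity
    nlinarith
  · have e1 : t / m ≤ T := (div_le_div_of_nonneg_left t0.le (by positivity) hj1).trans hc.le
    have e2 := quadExpSum_le p (show 0 ≤ t / m by positivity)
    have e3 := hT' t ((le_max_right _ _).trans ht)
    nlinarith

/-- With y = x/k, two powers of y exp(-y) are kept and the other k - 2 are bounded by their maximum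
exp(-1). What remains is a term of F at argument 2t/k. -/
theorem pow_mul_exp_neg_le {k : ℕ} (hk : 2 ≤ k) {x : ℝ} (hx : 0 ≤ x) :
    x ^ k * Real.exp (-x) ≤
      (k : ℝ) ^ k * Real.exp (2 - k) * ((x / k) ^ 2 * Real.exp (-(2 * x / k))) := by
  obtain ⟨m, rfl⟩ := Nat.exists_eq_add_of_le hk
  have k0 : (0 : ℝ) < ((2 + m : ℕ) : ℝ) := by positivity
  set K : ℝ := ((2 + m : ℕ) : ℝ) with hK
  have hKm : K = 2 + m := by rw [hK]; push_cast; ring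
  obtain ⟨y, rfl⟩ : ∃ y, x = y * K := ⟨x / K, by field_simp⟩
  have y0 : 0 ≤ y := by
    by_contra! h
    nlinarith
  have e1 : y ≤ Real.exp (y - 1) := by linarith [Real.add_one_le_exp (y - 1)]
  have e2 : y ^ m ≤ Real.exp (m * (y - 1)) := by
    rw [Real.exp_nat_mul]; gcongr
  have e3 : Real.exp (-(y * K)) =
      Real.exp (2 - K) * Real.exp (-(2 * y)) * Real.exp (-(m * (y - 1))) := by
    rw [← Real.exp_add, ← Real.exp_add, hKm]; congr 1; ring
  have e4 : Real.exp (m * (y - 1)) * Real.exp (-(m * (y - 1))) = 1 := by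
    rw [← Real.exp_add]; simp
  rw [mul_div_cancel_right₀ _ k0.ne', show 2 * (y * K) / K = 2 * y by field_simp, mul_pow, e3,
    pow_add y]
  calc _ = K ^ (2 + m) * Real.exp (2 - K) * (y ^ 2 * Real.exp (-(2 * y))) *
        (y ^ m * Real.exp (-(m * (y - 1)))) := by ring
    _ ≤ K ^ (2 + m) * Real.exp (2 - K) * (y ^ 2 * Real.exp (-(2 * y))) *
        (Real.exp (m * (y - 1)) * Real.exp (-(m * (y - 1)))) := by gcongr
    _ = _ := by rw [e4, mul_one]

/-- The √k in Stirling's lower bound for k! absorbs the √(k/2) lost in the Potter bound for F. The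
constants come from (17/5)²/2 ≤ 2π and e² ≤ 37/5. -/
theorem pow_self_mul_exp_le {k : ℕ} (hk : 2 ≤ k) :
    (k : ℝ) ^ k * Real.exp (2 - k) * (17 / 5 * √(k / 2)) ≤ 37 / 5 * k.factorial := by
  have h := Stirling.le_factorial_stirling k
  have hpi : (17 / 5 : ℝ) * √(k / 2) ≤ √(2 * Real.pi * k) := by
    refine Real.le_sqrt_of_sq_le ?_
    rw [mul_pow, Real.sq_sqrt (by positivity)]
    have := Real.pi_gt_three
    have : (2 : ℝ) ≤ k := by exact_mod_cast hk
    nlinarith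
  have he : Real.exp 2 ≤ 37 / 5 := by
    have := Real.exp_one_lt_d9
    have h2 : Real.exp 2 = Real.exp 1 ^ 2 := by rw [← Real.exp_nat_mul]; norm_num
    rw [h2]; nlinarith [Real.exp_pos 1]
  have e1 : (k : ℝ) ^ k * Real.exp (2 - k) = Real.exp 2 * (k / Real.exp 1) ^ k := by
    rw [div_pow, ← Real.exp_nat_mul, mul_one, Real.exp_sub]; ring
  calc _ = Real.exp 2 * ((17 / 5 * √(k / 2)) * (k / Real.exp 1) ^ k) := by rw [e1]; ring
    _ ≤ 37 / 5 * (√(2 * Real.pi * k) * (k / Real.exp 1) ^ k) := by gcongr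
    _ ≤ _ := by gcongr

/-- The expected number of symbols with exactly `k` occurrences in a Poisson sample of size `t`
is at most `6 * a t`, uniformly in `k ≥ 2`. -/
theorem exists_sum_poisson_le
    (h : ExtendedSlowVariation (fun x : ℝ => counting p (1 / x)) a)
    (ha : Tendsto a atTop atTop) :
    ∃ T : ℝ, 0 < T ∧ ∀ t, T ≤ t → 0 < a t ∧ ∀ k : ℕ, 2 ≤ k → ∀ J : Finset ℕ,
      ∑ j ∈ J, (t * (p j).toReal) ^ k * Real.exp (-(t * (p j).toReal)) / k.factorial
        ≤ 6 * a t := by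
  obtain ⟨T, T0, hT⟩ := exists_quadExpSum_div_le h ha
  refine ⟨T, T0, fun t ht => ⟨(hT t ht).1, fun k hk J => ?_⟩⟩
  obtain ⟨a0, hm⟩ := hT t ht
  have t0 : 0 < t := T0.trans_le ht
  have k2 : (2 : ℝ) ≤ k := by exact_mod_cast hk
  have k0 : (0 : ℝ) < k := by linarith
  have e1 := hm (k / 2) (by linarith)
  have e2 : ∑ j ∈ J, (t / (k / 2) * (p j).toReal) ^ 2 * Real.exp (-(t / (k / 2) * (p j).toReal))
      ≤ quadExpSum p (t / (k / 2)) :=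
    (summable_quadExp p (by positivity)).sum_le_tsum J fun j _ => by positivity
  rw [← Finset.sum_div, div_le_iff₀ (by positivity)]
  set A : ℝ := (k : ℝ) ^ k * Real.exp (2 - k) with hA
  have A0 : 0 < A := by positivity
  have e3 : ∑ j ∈ J, (t * (p j).toReal) ^ k * Real.exp (-(t * (p j).toReal)) ≤
      A / 4 * ∑ j ∈ J, (t / (k / 2) * (p j).toReal) ^ 2 *
        Real.exp (-(t / (k / 2) * (p j).toReal)) := by
    rw [Finset.mul_sum]
    refine Finset.sum_le_sum fun j _ => ?_
    have hx : 0 ≤ t * (p j).toReal := by positivity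
    refine (pow_mul_exp_neg_le hk hx).trans_eq ?_
    rw [← hA, show 2 * (t * (p j).toReal) / k = t / (k / 2) * (p j).toReal by field_simp]
    field_simp
    ring
  have e4 := pow_self_mul_exp_le hk
  rw [← hA] at e4
  calc _ ≤ A / 4 * (8 * √(k / 2) * a t) := by
        refine e3.trans ?_
        gcongr
        exact e2.trans e1
    _ = 10 / 17 * a t * (A * (17 / 5 * √(k / 2))) := by ring
    _ ≤ 10 / 17 * a t * (37 / 5 * k.factorial) := by gcongr
    _ ≤ _ := by
      have : 0 < a t * k.factorial := by positivity
      nlinarith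

/-- Expand exp(λ p_j) - 1 - λ p_j in powers of λ/t; the uniform bound on the coefficients leaves a
geometric series starting at (λ/t)². The 12 is twice the 6 of `exists_sum_poisson_le`. -/
theorem exists_sum_exp_sub_le
    (h : ExtendedSlowVariation (fun x : ℝ => counting p (1 / x)) a)
    (ha : Tendsto a atTop atTop) :
    ∃ T : ℝ, 0 < T ∧ ∀ t, T ≤ t → 0 < a t ∧ ∀ lam : ℝ, 0 < lam → lam < t → ∀ J : Finset ℕ,
      ∑ j ∈ J, Real.exp (-(t * (p j).toReal)) *
          (Real.exp (lam * (p j).toReal) - 1 - lam * (p j).toReal)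
        ≤ 12 * a t / t ^ 2 * lam ^ 2 / (2 * (1 - lam / t)) := by
  obtain ⟨T, T0, hT⟩ := exists_sum_poisson_le h ha
  refine ⟨T, T0, fun t ht => ⟨(hT t ht).1, fun lam hl hlt J => ?_⟩⟩
  obtain ⟨a0, hk⟩ := hT t ht
  have t0 : 0 < t := T0.trans_le ht
  have u1 : lam / t < 1 := (div_lt_one t0).2 hlt
  have hexp : ∀ j, HasSum (fun k : ℕ => Real.exp (-(t * (p j).toReal)) *
      ((lam * (p j).toReal) ^ (k + 2) / (k + 2).factorial))
      (Real.exp (-(t * (p j).toReal)) *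
          (Real.exp (lam * (p j).toReal) - 1 - lam * (p j).toReal)) := by
    intro j
    have e := NormedSpace.expSeries_div_hasSum_exp (𝔸 := ℝ) (lam * (p j).toReal)
    rw [← Real.exp_eq_exp_ℝ] at e
    have e2 := (hasSum_nat_add_iff' 2).2 e
    simp only [Finset.sum_range_succ, Finset.sum_range_zero] at e2
    refine HasSum.mul_left _ ?_
    convert! e2 using 1
    simp; ring
  have hgeo := (hasSum_geometric_of_lt_one (div_pos hl t0).le u1).mul_left
    (6 * a t * (lam / t) ^ 2)
  refine (hasSum_le (fun k => ?_) (hasSum_sum fun j (_ : j ∈ J) => hexp j) hgeo).trans_eq ?_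
  · have e := hk (k + 2) (by omega) J
    calc _ = (lam / t) ^ (k + 2) * ∑ j ∈ J, (t * (p j).toReal) ^ (k + 2) *
          Real.exp (-(t * (p j).toReal)) / (k + 2).factorial := by
          rw [Finset.mul_sum]
          refine Finset.sum_congr rfl fun j _ => ?_
          rw [show lam * (p j).toReal = lam / t * (t * (p j).toReal) by field_simp, mul_pow]
          ring
      _ ≤ (lam / t) ^ (k + 2) * (6 * a t) := by gcongr
      _ = _ := by ring
  · have : 1 - lam / t ≠ 0 := by linarith
    field_simp
    ring

end Asymptotics

/-! ### Weighted sums of indicators: Laplace transform and variance -/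

section WeightedEvents

variable {Ω : Type*}

theorem prod_indicator_const {ι : Type*} (E : ι → Set Ω) (c : ι → ℝ) (A : Finset ι) (ω : Ω) :
    ∏ j ∈ A, (E j).indicator (fun _ => c j) ω =
      (⋂ j ∈ A, E j).indicator (fun _ => ∏ j ∈ A, c j) ω := by
  classical
  by_cases h : ∀ j ∈ A, ω ∈ E j
  · rw [Set.indicator_of_mem (by simpa using h)]
    exact Finset.prod_congr rfl fun j hj => Set.indicator_of_mem (h j hj) _
  · rw [Set.indicator_of_notMem (by simpa using h)]
    push Not at h
    obtain ⟨j, hj, hω⟩ := h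
    exact Finset.prod_eq_zero hj (Set.indicator_of_notMem hω _)

variable {E : ℕ → Set Ω} {x : ℕ → ℝ}

theorem summable_indicator_weight (hx0 : ∀ j, 0 ≤ x j) (hx : Summable x) (ω : Ω) :
    Summable fun j => (E j).indicator (fun _ => x j) ω :=
  Summable.of_nonneg_of_le (fun j => Set.indicator_nonneg (fun _ _ => hx0 j) ω)
    (fun j => Set.indicator_le_self' (fun _ _ => hx0 j) ω) hx

variable [MeasurableSpace Ω] {P : Measure Ω}

theorem nullMeasurableSet_biInter_finset {ι : Type*} {E : ι → Set Ω}
    (hE : ∀ j, NullMeasurableSet (E j) P) (A : Finset ι) :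
    NullMeasurableSet (⋂ j ∈ A, E j) P :=
  NullMeasurableSet.biInter A.countable_toSet fun j _ => hE j

theorem integral_indicator_const₀ {E : Set Ω} (hE : NullMeasurableSet E P) (c : ℝ) :
    ∫ ω, E.indicator (fun _ => c) ω ∂P = P.real E * c := by
  rw [integral_indicator₀ hE, setIntegral_const, smul_eq_mul]

theorem aemeasurable_tsum_indicator (hE : ∀ j, NullMeasurableSet (E j) P) (hx0 : ∀ j, 0 ≤ x j)
    (hx : Summable x) :
    AEMeasurable (fun ω => ∑' j, (E j).indicator (fun _ => x j) ω) P := by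
  refine aemeasurable_of_tendsto_metrizable_ae atTop
    (f := fun n ω => ∑ j ∈ Finset.range n, (E j).indicator (fun _ => x j) ω)
    (fun n => Finset.aemeasurable_fun_sum _ fun j _ => aemeasurable_const.indicator₀ (hE j)) ?_
  exact Eventually.of_forall fun ω =>
    (summable_indicator_weight hx0 hx ω).hasSum.tendsto_sum_nat

variable [IsProbabilityMeasure P]

theorem integrable_indicator_const₀ {E : Set Ω} (hE : NullMeasurableSet E P) (c : ℝ) :
    Integrable (E.indicator fun _ => c) P :=
  (integrable_const c).indicator₀ hE

/-- The exponential moment of a weighted sum of indicators of events whose intersections are at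
most as probable as if they were independent. -/
theorem integral_prod_one_add_indicator_le {ι : Type*} {E : ι → Set Ω}
    (hE : ∀ j, NullMeasurableSet (E j) P) {q c : ι → ℝ} (hc : ∀ j, 0 ≤ c j)
    (hq : ∀ A : Finset ι, P.real (⋂ j ∈ A, E j) ≤ ∏ j ∈ A, q j) (J : Finset ι) :
    ∫ ω, ∏ j ∈ J, (1 + (E j).indicator (fun _ => c j) ω) ∂P ≤ ∏ j ∈ J, (1 + c j * q j) := by
  classical
  -- Expanding over subsets leaves only nonnegative coefficients, so bounds on intersections
  -- suffice.
  simp only [Finset.prod_one_add, prod_indicator_const]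
  rw [integral_finsetSum _ fun A _ => integrable_indicator_const₀
    (nullMeasurableSet_biInter_finset hE A) _]
  refine Finset.sum_le_sum fun A _ => ?_
  rw [integral_indicator_const₀ (nullMeasurableSet_biInter_finset hE A), Finset.prod_mul_distrib,
    mul_comm]
  exact mul_le_mul_of_nonneg_left (hq A) (Finset.prod_nonneg fun j _ => hc j)

variable {q : ℕ → ℝ}

theorem hasSum_integral_indicator {ι : Type*} [Countable ι] {E : ι → Set Ω} {x : ι → ℝ}
    (hE : ∀ j, NullMeasurableSet (E j) P) (hx0 : ∀ j, 0 ≤ x j) (hx : Summable x) :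
    HasSum (fun j => x j * P.real (E j)) (∫ ω, ∑' j, (E j).indicator (fun _ => x j) ω ∂P) := by
  have h := hasSum_integral_of_summable_integral_norm (μ := P)
    (F := fun j => (E j).indicator fun _ => x j)
    (fun j => integrable_indicator_const₀ (hE j) (x j)) ?_
  · simpa only [integral_indicator_const₀ (hE _), mul_comm] using h
  · simp only [Real.norm_of_nonneg (Set.indicator_nonneg (fun _ _ => hx0 _) _),
      integral_indicator_const₀ (hE _)]
    exact Summable.of_nonneg_of_le (fun j => mul_nonneg measureReal_nonneg (hx0 j))
      (fun j => mul_le_of_le_one_left (hx0 j) measureReal_le_one) hx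

/-- For partial sums, exp(λ S_n) is a product of factors 1 + 1_E (exp(λ x_j) - 1), whose mean is
bounded as under independence, and then 1 + u ≤ exp u. Centring at the full mean is harmless, as
partial means lie below it. Dominated convergence removes the truncation. -/
theorem centredLogLaplace_tsum_indicator_le (hE : ∀ j, NullMeasurableSet (E j) P)
    (hx0 : ∀ j, 0 ≤ x j) (hx : Summable x)
    (hA : ∀ A : Finset ℕ, P.real (⋂ j ∈ A, E j) ≤ ∏ j ∈ A, q j)
    (hq : ∀ j, P.real (E j) = q j) {lam B : ℝ} (hl : 0 < lam)
    (hB : ∀ J : Finset ℕ, ∑ j ∈ J, q j * (Real.exp (lam * x j) - 1 - lam * x j) ≤ B) :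
    centredLogLaplace P (fun ω => ∑' j, (E j).indicator (fun _ => x j) ω) lam ≤ B := by
  have hq0 : ∀ j, 0 ≤ q j := fun j => hq j ▸ measureReal_nonneg
  have hB0 : 0 ≤ B := by simpa using hB ∅
  have hm := hasSum_integral_indicator hE hx0 hx
  simp only [hq] at hm
  set m := ∫ ω, ∑' j, (E j).indicator (fun _ => x j) ω ∂P with hmdef
  set S : ℕ → Ω → ℝ := fun n ω => ∑ j ∈ Finset.range n, (E j).indicator (fun _ => x j) ω with hS
  have hlim : Tendsto (fun n => ∫ ω, Real.exp (lam * (S n ω - m)) ∂P) atTop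
      (𝓝 (∫ ω, Real.exp (lam * (∑' j, (E j).indicator (fun _ => x j) ω - m)) ∂P)) := by
    refine tendsto_integral_of_dominated_convergence
      (fun _ => Real.exp (lam * (∑' j, x j - m))) (fun n => ?_) (integrable_const _)
      (fun n => Eventually.of_forall fun ω => ?_) (Eventually.of_forall fun ω => ?_)
    · have : AEMeasurable (S n) P :=
        Finset.aemeasurable_fun_sum _ fun j _ => aemeasurable_const.indicator₀ (hE j)
      exact ((this.sub_const m).const_mul lam).exp.aestronglyMeasurable
    · rw [Real.norm_of_nonneg (Real.exp_nonneg _)]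
      gcongr
      exact (Finset.sum_le_sum fun j _ => Set.indicator_le_self' (fun _ _ => hx0 j) ω).trans
        (hx.sum_le_tsum _ fun j _ => hx0 j)
    · have h := (summable_indicator_weight hx0 hx ω (E := E)).hasSum.tendsto_sum_nat
      exact (Real.continuous_exp.tendsto _).comp ((h.sub_const m).const_mul lam)
  have hbound : ∀ n, ∫ ω, Real.exp (lam * (S n ω - m)) ∂P ≤ Real.exp B := by
    intro n
    have e1 : ∀ ω, Real.exp (lam * (S n ω - m)) = Real.exp (-(lam * m)) *
        ∏ j ∈ Finset.range n,
          (1 + (E j).indicator (fun _ => Real.exp (lam * x j) - 1) ω) := by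
      intro ω
      rw [mul_sub, sub_eq_neg_add, Real.exp_add, hS, Finset.mul_sum, Real.exp_sum]
      congr 1
      refine Finset.prod_congr rfl fun j _ => ?_
      by_cases h : ω ∈ E j <;> simp [h]
    simp only [e1]
    rw [integral_const_mul]
    have e2 := integral_prod_one_add_indicator_le hE (c := fun j => Real.exp (lam * x j) - 1)
      (fun j => by
        have := Real.add_one_le_exp (lam * x j)
        have := mul_nonneg hl.le (hx0 j)
        linarith) hA (Finset.range n)
    have e3 : ∏ j ∈ Finset.range n, (1 + (Real.exp (lam * x j) - 1) * q j) ≤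
        Real.exp (∑ j ∈ Finset.range n, (Real.exp (lam * x j) - 1) * q j) := by
      rw [Real.exp_sum]
      refine Finset.prod_le_prod (fun j _ => ?_) fun j _ => ?_
      · have := Real.add_one_le_exp (lam * x j)
        have := mul_nonneg hl.le (hx0 j)
        have : 0 ≤ (Real.exp (lam * x j) - 1) * q j := mul_nonneg (by linarith) (hq0 j)
        linarith
      · rw [add_comm]; exact Real.add_one_le_exp _
    have e4 : ∑ j ∈ Finset.range n, (Real.exp (lam * x j) - 1) * q j ≤ B + lam * m := by
      have h1 := hB (Finset.range n)
      have h2 := sum_le_hasSum (Finset.range n) (fun j _ => mul_nonneg (hx0 j) (hq0 j)) hm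
      calc _ = ∑ j ∈ Finset.range n, q j * (Real.exp (lam * x j) - 1 - lam * x j) +
            lam * ∑ j ∈ Finset.range n, x j * q j := by
            rw [Finset.mul_sum, ← Finset.sum_add_distrib]
            exact Finset.sum_congr rfl fun j _ => by ring
        _ ≤ _ := by gcongr
    calc _ ≤ Real.exp (-(lam * m)) * Real.exp (B + lam * m) := by
          gcongr; exact e2.trans (e3.trans (Real.exp_le_exp.2 e4))
      _ = Real.exp B := by rw [← Real.exp_add]; congr 1; ring
  have hfin := le_of_tendsto' hlim hbound
  unfold centredLogLaplace
  -- If the integral were 0, `Real.log 0 = 0` and 0 ≤ B would still suffice, so its positivity need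
  -- not be proved.
  rcases (integral_nonneg fun ω => (Real.exp_pos _).le :
    0 ≤ ∫ ω, Real.exp (lam * (∑' j, (E j).indicator (fun _ => x j) ω - m)) ∂P).eq_or_lt
    with h0 | h0
  · rw [← hmdef, ← h0]; simpa using hB0
  · exact (Real.log_le_iff_le_exp h0).2 hfin

theorem hasSum_integral_tsum_indicator_sq (hE : ∀ j, NullMeasurableSet (E j) P)
    (hx0 : ∀ j, 0 ≤ x j) (hx : Summable x) :
    HasSum (fun z : ℕ × ℕ => x z.1 * x z.2 * P.real (E z.1 ∩ E z.2))
      (∫ ω, (∑' j, (E j).indicator (fun _ => x j) ω) ^ 2 ∂P) := by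
  have hsq : ∀ ω, (∑' j, (E j).indicator (fun _ => x j) ω) ^ 2 =
      ∑' z : ℕ × ℕ, (E z.1 ∩ E z.2).indicator (fun _ => x z.1 * x z.2) ω := by
    intro ω
    have hs := summable_indicator_weight (E := E) hx0 hx ω
    have h0 : ∀ j, 0 ≤ (E j).indicator (fun _ => x j) ω := fun j =>
      Set.indicator_nonneg (fun _ _ => hx0 j) ω
    rw [sq, hs.tsum_mul_tsum hs (hs.mul_of_nonneg hs h0 h0)]
    refine tsum_congr fun z => ?_
    by_cases h1 : ω ∈ E z.1 <;> by_cases h2 : ω ∈ E z.2 <;> simp [h1, h2]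
  simp only [hsq]
  exact hasSum_integral_indicator (P := P) (E := fun z : ℕ × ℕ => E z.1 ∩ E z.2)
    (x := fun z => x z.1 * x z.2) (fun z => (hE z.1).inter (hE z.2))
    (fun z => mul_nonneg (hx0 _) (hx0 _)) (hx.mul_of_nonneg hx hx0 hx0)

/-- The variance of a weighted sum of indicators of events that are almost pairwise
uncorrelated. -/
theorem abs_variance_tsum_indicator_sub_le (hE : ∀ j, NullMeasurableSet (E j) P)
    (hx0 : ∀ j, 0 ≤ x j) (hx : Summable x) (hq : ∀ j, P.real (E j) = q j)
    {K : ℝ} (hK0 : 0 ≤ K) {s : ℕ → ℝ} (hs0 : ∀ j, 0 ≤ s j) (hs : Summable fun j => x j ^ 2 * s j)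
    (hcov : ∀ i j, i ≠ j →
      |P.real (E i ∩ E j) - q i * q j| ≤ K * (x i * s i) * (x j * s j)) :
    |Var[fun ω => ∑' j, (E j).indicator (fun _ => x j) ω; P] -
      ∑' j, x j ^ 2 * (q j - q j ^ 2)| ≤ K * (∑' j, x j ^ 2 * s j) ^ 2 := by
  have hq0 : ∀ j, 0 ≤ q j := fun j => hq j ▸ measureReal_nonneg
  have hsum := summable_indicator_weight (E := E) hx0 hx
  have hm := hasSum_integral_indicator hE hx0 hx
  simp only [hq] at hm
  have hxx : Summable fun z : ℕ × ℕ => x z.1 * x z.2 := hx.mul_of_nonneg hx hx0 hx0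
  have hsq := hasSum_integral_tsum_indicator_sq hE hx0 hx
  have hmm : HasSum (fun z : ℕ × ℕ => x z.1 * q z.1 * (x z.2 * q z.2))
      ((∫ ω, ∑' j, (E j).indicator (fun _ => x j) ω ∂P) ^ 2) := by
    have h0 : ∀ j, 0 ≤ x j * q j := fun j => mul_nonneg (hx0 j) (hq0 j)
    rw [sq]
    exact hm.mul hm (hm.summable.mul_of_nonneg hm.summable h0 h0)
  have hL2 : MemLp (fun ω => ∑' j, (E j).indicator (fun _ => x j) ω) 2 P := by
    refine MemLp.of_bound (aemeasurable_tsum_indicator hE hx0 hx).aestronglyMeasurable (∑' j, x j)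
      (Eventually.of_forall fun ω => ?_)
    rw [Real.norm_of_nonneg (tsum_nonneg fun j => Set.indicator_nonneg (fun _ _ => hx0 j) ω)]
    exact (hsum ω).tsum_le_tsum (fun j => Set.indicator_le_self' (fun _ _ => hx0 j) ω) hx
  have hvar := variance_eq_sub hL2
  have hdiag : HasSum (fun z : ℕ × ℕ => if z.1 = z.2 then x z.1 ^ 2 * (q z.1 - q z.1 ^ 2) else 0)
      (∑' j, x j ^ 2 * (q j - q j ^ 2)) := by
    have hsd : Summable fun j => x j ^ 2 * (q j - q j ^ 2) := by
      have hinj : Function.Injective fun j : ℕ => (j, j) := fun i j h => (Prod.ext_iff.1 h).1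
      refine Summable.of_norm_bounded (hxx.comp_injective hinj) fun j => ?_
      have h1 : q j ≤ 1 := hq j ▸ measureReal_le_one
      have h2 : 0 ≤ q j - q j ^ 2 := by nlinarith [hq0 j]
      rw [Real.norm_of_nonneg (by positivity)]
      simp only [Function.comp]
      nlinarith [sq_nonneg (x j), sq_nonneg (q j)]
    have hinj : Function.Injective fun j : ℕ => (j, j) := fun i j h => (Prod.ext_iff.1 h).1
    refine (hinj.hasSum_iff fun z hz => if_neg fun h => hz ⟨z.1, Prod.ext rfl h⟩).1 ?_
    simpa [Function.comp_def] using hsd.hasSum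
  have htot := (hsq.sub hmm).sub hdiag
  have hG : HasSum (fun z : ℕ × ℕ => K * (x z.1 ^ 2 * s z.1 * (x z.2 ^ 2 * s z.2)))
      (K * (∑' j, x j ^ 2 * s j) ^ 2) := by
    have h0 : ∀ j, 0 ≤ x j ^ 2 * s j := fun j => mul_nonneg (sq_nonneg _) (hs0 j)
    rw [sq]
    exact (hs.hasSum.mul hs.hasSum (hs.mul_of_nonneg hs h0 h0)).mul_left K
  rw [hvar]
  refine htot.norm_le_of_bounded hG fun z => ?_
  -- The diagonal terms cancel exactly; off the diagonal a covariance remains, and its bound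
  -- factorises over the two indices.
  by_cases hz : z.1 = z.2
  · have h0 : 0 ≤ K * (x z.1 ^ 2 * s z.1 * (x z.2 ^ 2 * s z.2)) :=
      mul_nonneg hK0 (mul_nonneg (mul_nonneg (sq_nonneg _) (hs0 _))
        (mul_nonneg (sq_nonneg _) (hs0 _)))
    rw [if_pos hz, ← hz, Set.inter_self, hq]
    rw [← hz] at h0
    convert! h0 using 1
    rw [norm_eq_zero]
    ring
  · rw [if_neg hz, sub_zero]
    have hxz := mul_nonneg (hx0 z.1) (hx0 z.2)
    calc _ = x z.1 * x z.2 * |P.real (E z.1 ∩ E z.2) - q z.1 * q z.2| := by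
          rw [Real.norm_eq_abs, ← abs_of_nonneg hxz, ← abs_mul, abs_of_nonneg hxz]
          congr 1; ring
      _ ≤ x z.1 * x z.2 * (K * (x z.1 * s z.1) * (x z.2 * s z.2)) := by
          gcongr; exact hcov _ _ hz
      _ = _ := by ring

end WeightedEvents

/-! ### Probabilities of missing symbols, and the Laplace bounds -/

section Occupancy

variable {Ω : Type*} {p : PMF ℕ} {U : ℕ → Ω → ℕ}

theorem sum_toReal_le_one (p : PMF ℕ) (A : Finset ℕ) : ∑ j ∈ A, (p j).toReal ≤ 1 :=
  sum_le_hasSum A (fun _ _ => ENNReal.toReal_nonneg) (hasSum_toReal p)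

theorem missingMass_eq_tsum_indicator (n : ℕ) :
    missingMass p U n =
      fun ω => ∑' j, {ω | count U n j ω = 0}.indicator (fun _ => (p j).toReal) ω := by
  ext ω; simp [missingMass, rareMass, Set.indicator_apply]

theorem poissonMissingMass_eq_tsum_indicator (N : ℝ≥0 → Ω → ℕ) (t : ℝ≥0) :
    poissonMissingMass p U N t =
      fun ω => ∑' j, {ω | count U (N t ω) j ω = 0}.indicator (fun _ => (p j).toReal) ω := by
  ext ω; simp [poissonMissingMass, missingMass, rareMass, Set.indicator_apply]

theorem count_eq_zero_iff {n j : ℕ} {ω : Ω} : count U n j ω = 0 ↔ ∀ i < n, U i ω ≠ j := by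
  simp [count, Finset.filter_eq_empty_iff]

theorem biInter_count_eq_zero (n : ℕ) (A : Finset ℕ) :
    ⋂ j ∈ A, {ω | count U n j ω = 0} = ⋂ i ∈ Finset.range n, U i ⁻¹' (A : Set ℕ)ᶜ := by
  ext ω
  simp only [Set.mem_iInter, Set.mem_ofPred_eq, count_eq_zero_iff, Finset.mem_range,
    Set.mem_preimage, Set.mem_compl_iff, Finset.mem_coe]
  exact ⟨fun h i hi hA => h _ hA i hi rfl, fun h j hj i hi hij => h i hi (hij ▸ hj)⟩

theorem biInter_count_random_size_eq_zero (N : Ω → ℕ) (A : Finset ℕ) :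
    ⋂ j ∈ A, {ω | count U (N ω) j ω = 0} =
      ⋃ n, N ⁻¹' {n} ∩ ⋂ j ∈ A, {ω | count U n j ω = 0} := by
  ext ω; simp

variable [MeasurableSpace Ω] {P : Measure Ω}

theorem IsSample.nullMeasurableSet_count (h : IsSample p P U) (n j : ℕ) :
    NullMeasurableSet {ω | count U n j ω = 0} P := by
  have e := biInter_count_eq_zero (U := U) n {j}
  simp only [Finset.mem_singleton, Set.iInter_iInter_eq_left] at e
  rw [e]
  exact NullMeasurableSet.biInter (Finset.countable_toSet _) fun i _ =>
    (h.law i).aemeasurable.nullMeasurableSet_preimage (MeasurableSet.of_discrete)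

variable {N : ℝ≥0 → Ω → ℕ}

theorem IsPoissonSample.nullMeasurableSet_count (h : IsPoissonSample p P U N) (t : ℝ≥0) (j : ℕ) :
    NullMeasurableSet {ω | count U (N t ω) j ω = 0} P := by
  have e := biInter_count_random_size_eq_zero (U := U) (N t) {j}
  simp only [Finset.mem_singleton, Set.iInter_iInter_eq_left] at e
  rw [e]
  exact NullMeasurableSet.iUnion fun n =>
    ((h.law_size t).aemeasurable.nullMeasurableSet_preimage MeasurableSet.of_discrete).inter
      (h.sample.nullMeasurableSet_count n j)

theorem IsSample.measureReal_notMem (h : IsSample p P U) (i : ℕ) (A : Finset ℕ) :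
    P.real (U i ⁻¹' (A : Set ℕ)ᶜ) = 1 - ∑ j ∈ A, (p j).toReal := by
  rw [measureReal_def, ← Measure.map_apply_of_aemeasurable (h.law i).aemeasurable
    MeasurableSet.of_discrete, (h.law i).map_eq, ← measureReal_def,
    probReal_compl_eq_one_sub MeasurableSet.of_discrete, measureReal_def,
    PMF.toMeasure_apply_finset, ENNReal.toReal_sum fun j _ => p.apply_ne_top j]

/-- The probability that no symbol of `A` occurs among the first `n` draws. -/
theorem IsSample.measureReal_biInter_count (h : IsSample p P U) (n : ℕ) (A : Finset ℕ) :
    P.real (⋂ j ∈ A, {ω | count U n j ω = 0}) = (1 - ∑ j ∈ A, (p j).toReal) ^ n := by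
  rw [biInter_count_eq_zero, measureReal_def,
    h.indep.measure_inter_preimage_eq_mul _ (fun _ _ => MeasurableSet.of_discrete),
    ENNReal.toReal_prod]
  simp only [← measureReal_def, h.measureReal_notMem, Finset.prod_const, Finset.card_range]

theorem IsSample.measureReal_count (h : IsSample p P U) (n j : ℕ) :
    P.real {ω | count U n j ω = 0} = (1 - (p j).toReal) ^ n := by
  simpa using h.measureReal_biInter_count n {j}

variable [IsProbabilityMeasure P]

/-- The probability that no symbol of `A` occurs in a Poisson sample of mean size `t`. -/
theorem IsPoissonSample.measureReal_biInter_count (h : IsPoissonSample p P U N) (t : ℝ≥0)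
    (A : Finset ℕ) :
    P.real (⋂ j ∈ A, {ω | count U (N t ω) j ω = 0}) =
      Real.exp (-(t * ∑ j ∈ A, (p j).toReal)) := by
  -- Split according to the sample size; summing these terms gives an exponential series.
  have hterm : ∀ n, P.real (N t ⁻¹' {n} ∩ ⋂ j ∈ A, {ω | count U n j ω = 0}) =
      Real.exp (-t) * ((t * (1 - ∑ j ∈ A, (p j).toReal)) ^ n / n.factorial) := by
    intro n
    have hset : ⋂ j ∈ A, {ω | count U n j ω = 0} =
        (fun ω i => U i ω) ⁻¹' {u | ∀ i < n, u i ∉ A} := by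
      rw [biInter_count_eq_zero]; ext ω; simp
    have hmeas : MeasurableSet {u : ℕ → ℕ | ∀ i < n, u i ∉ A} := by
      have : {u : ℕ → ℕ | ∀ i < n, u i ∉ A} =
          ⋂ i ∈ Finset.range n, (fun u : ℕ → ℕ => u i) ⁻¹' (A : Set ℕ)ᶜ := by
        ext u; simp
      rw [this]
      exact Finset.measurableSet_biInter _ fun i _ =>
        measurable_pi_apply i MeasurableSet.of_discrete
    have hind := (h.indep_size t).measure_inter_preimage_eq_mul {n} _
      MeasurableSet.of_discrete hmeas
    rw [← hset] at hind
    rw [measureReal_def, hind, ENNReal.toReal_mul, ← measureReal_def, ← measureReal_def,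
      h.sample.measureReal_biInter_count, measureReal_def,
      ← Measure.map_apply_of_aemeasurable (h.law_size t).aemeasurable MeasurableSet.of_discrete,
      (h.law_size t).map_eq, ← measureReal_def, poissonMeasure_real_singleton, mul_pow]
    ring
  rw [biInter_count_random_size_eq_zero, measureReal_def, measure_iUnion₀ ?_ ?_,
    ENNReal.tsum_toReal_eq fun n => measure_ne_top _ _]
  · simp only [← measureReal_def, hterm]
    have e := NormedSpace.expSeries_div_hasSum_exp (𝔸 := ℝ) (t * (1 - ∑ j ∈ A, (p j).toReal))
    rw [← Real.exp_eq_exp_ℝ] at e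
    rw [tsum_mul_left, e.tsum_eq, ← Real.exp_add]
    congr 1; ring
  · intro m n hmn
    refine Disjoint.aedisjoint (Set.disjoint_left.2 fun ω h1 h2 => hmn ?_)
    exact h1.1.symm.trans h2.1
  · exact fun n =>
      ((h.law_size t).aemeasurable.nullMeasurableSet_preimage MeasurableSet.of_discrete).inter
        (nullMeasurableSet_biInter_finset (fun j => h.sample.nullMeasurableSet_count n j) A)

theorem IsPoissonSample.measureReal_count (h : IsPoissonSample p P U N) (t : ℝ≥0) (j : ℕ) :
    P.real {ω | count U (N t ω) j ω = 0} = Real.exp (-(t * (p j).toReal)) := by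
  simpa using h.measureReal_biInter_count t {j}

/-- Raised to the power n, this is the negative dependence of the events that symbols are missing.
-/
theorem one_sub_sum_le_prod_one_sub (p : PMF ℕ) (A : Finset ℕ) :
    1 - ∑ j ∈ A, (p j).toReal ≤ ∏ j ∈ A, (1 - (p j).toReal) := by
  classical
  induction A using Finset.induction_on with
  | empty => simp
  | insert i A hi ih =>
    rw [Finset.sum_insert hi, Finset.prod_insert hi]
    have h1 := toReal_le_one p i
    have h2 : 0 ≤ (p i).toReal := ENNReal.toReal_nonneg
    have h3 : 0 ≤ ∑ j ∈ A, (p j).toReal := Finset.sum_nonneg fun j _ => ENNReal.toReal_nonneg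
    nlinarith

theorem one_sub_pow_le_exp (p : PMF ℕ) (n j : ℕ) :
    (1 - (p j).toReal) ^ n ≤ Real.exp (-(n * (p j).toReal)) := by
  rw [← mul_neg, Real.exp_nat_mul]
  have := Real.one_sub_le_exp_neg (p j).toReal
  gcongr
  linarith [toReal_le_one p j]

theorem exp_sub_one_sub_nonneg (x : ℝ) : 0 ≤ Real.exp x - 1 - x := by
  linarith [Real.add_one_le_exp x]

theorem IsSample.centredLogLaplace_missingMass_le (h : IsSample p P U) {n : ℕ} {lam B : ℝ}
    (hl : 0 < lam) (hB : ∀ J : Finset ℕ, ∑ j ∈ J, Real.exp (-(n * (p j).toReal)) *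
      (Real.exp (lam * (p j).toReal) - 1 - lam * (p j).toReal) ≤ B) :
    centredLogLaplace P (missingMass p U n) lam ≤ B := by
  rw [missingMass_eq_tsum_indicator]
  refine centredLogLaplace_tsum_indicator_le (h.nullMeasurableSet_count n)
    (fun j => ENNReal.toReal_nonneg) (summable_toReal p) (fun A => ?_)
    (h.measureReal_count n) hl fun J => ?_
  · rw [h.measureReal_biInter_count, Finset.prod_pow]
    gcongr
    · linarith [sum_toReal_le_one p A]
    · exact one_sub_sum_le_prod_one_sub p A
  · refine (Finset.sum_le_sum fun j _ => ?_).trans (hB J)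
    gcongr
    · exact exp_sub_one_sub_nonneg _
    · exact one_sub_pow_le_exp p n j

theorem IsPoissonSample.centredLogLaplace_missingMass_le (h : IsPoissonSample p P U N) {t : ℝ≥0}
    {lam B : ℝ} (hl : 0 < lam) (hB : ∀ J : Finset ℕ, ∑ j ∈ J, Real.exp (-(t * (p j).toReal)) *
      (Real.exp (lam * (p j).toReal) - 1 - lam * (p j).toReal) ≤ B) :
    centredLogLaplace P (poissonMissingMass p U N t) lam ≤ B := by
  rw [poissonMissingMass_eq_tsum_indicator]
  refine centredLogLaplace_tsum_indicator_le (h.nullMeasurableSet_count t)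
    (fun j => ENNReal.toReal_nonneg) (summable_toReal p) (fun A => ?_)
    (h.measureReal_count t) hl hB
  rw [h.measureReal_biInter_count, ← Real.exp_sum, Finset.mul_sum, Finset.sum_neg_distrib]

end Occupancy

/-! ### Variance of the missing mass -/

section Variance

variable {p : PMF ℕ}

theorem hasSum_sq_mul_exp {t : ℝ} (ht : 0 < t) :
    HasSum (fun j => (p j).toReal ^ 2 * Real.exp (-(t * (p j).toReal)))
      (quadExpSum p t / t ^ 2) := by
  refine ((summable_quadExp p ht.le).hasSum.div_const (t ^ 2)).congr_fun fun j => ?_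
  field_simp

/-- The variance of the missing mass of a Poisson sample. -/
theorem hasSum_sq_mul_exp_sub_sq {t : ℝ} (ht : 0 < t) :
    HasSum (fun j => (p j).toReal ^ 2 * (Real.exp (-(t * (p j).toReal)) -
      Real.exp (-(t * (p j).toReal)) ^ 2))
      ((quadExpSum p t - quadExpSum p (2 * t) / 4) / t ^ 2) := by
  convert! (hasSum_sq_mul_exp (p := p) ht).sub
    (hasSum_sq_mul_exp (p := p) (show 0 < 2 * t by positivity)) using 1
  · ext j
    rw [← Real.exp_nat_mul]
    push_cast
    rw [show 2 * -(t * (p j).toReal) = -(2 * t * (p j).toReal) by ring]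
    ring
  · field_simp
    ring

variable {Ω : Type*} {U : ℕ → Ω → ℕ} [MeasurableSpace Ω] {P : Measure Ω}
  [IsProbabilityMeasure P]

theorem IsPoissonSample.variance_missingMass {N : ℝ≥0 → Ω → ℕ} (h : IsPoissonSample p P U N)
    {t : ℝ≥0} (ht : 0 < t) :
    Var[poissonMissingMass p U N t; P] =
      (quadExpSum p t - quadExpSum p (2 * t) / 4) / (t : ℝ) ^ 2 := by
  have e := abs_variance_tsum_indicator_sub_le (h.nullMeasurableSet_count t)
    (fun j => ENNReal.toReal_nonneg) (summable_toReal p) (h.measureReal_count t) (K := 0) le_rfl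
    (s := fun _ => 0) (fun _ => le_rfl) (by simp) (fun i j hij => by
      have e := h.measureReal_biInter_count t {i, j}
      simp only [Finset.mem_insert, Finset.mem_singleton, Set.iInter_iInter_eq_or_left,
        Set.iInter_iInter_eq_left, Finset.sum_pair hij] at e
      rw [e, ← Real.exp_add, mul_add, neg_add]
      simp)
  rw [(hasSum_sq_mul_exp_sub_sq (p := p) (NNReal.coe_pos.2 ht)).tsum_eq, zero_mul] at e
  rw [poissonMissingMass_eq_tsum_indicator]
  exact sub_eq_zero.1 (abs_nonpos_iff.1 e)

theorem exp_neg_pred_mul_le {n : ℕ} (hn : n ≠ 0) {x : ℝ} (h1 : x ≤ 1) :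
    Real.exp (-x) ^ (n - 1) ≤ Real.exp 1 * Real.exp (-(n * x)) := by
  obtain ⟨m, rfl⟩ := Nat.exists_eq_succ_of_ne_zero hn
  rw [← Real.exp_nat_mul, ← Real.exp_add, Real.exp_le_exp]
  simp only [Nat.succ_eq_add_one, Nat.add_sub_cancel]
  push_cast
  linarith

/-- A mean value bound for n-th powers, with exp(-x) - (1 - x) ≤ x². The factor e pays for the
exponent n - 1 in place of n. -/
theorem exp_neg_sub_one_sub_pow_le {n : ℕ} (hn : n ≠ 0) {x : ℝ} (h0 : 0 ≤ x) (h1 : x ≤ 1) :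
    |(1 - x) ^ n - Real.exp (-(n * x))| ≤ n * x ^ 2 * (Real.exp 1 * Real.exp (-(n * x))) := by
  have e1 := Real.one_sub_le_exp_neg x
  have e2 : Real.exp (-x) - (1 - x) ≤ x ^ 2 := by
    have := Real.abs_exp_sub_one_sub_id_le (x := -x) (by rw [abs_neg, abs_of_nonneg h0]; exact h1)
    have := (abs_le.1 this).2
    linarith [neg_sq x]
  have e3 := abs_pow_sub_pow_le (1 - x) (Real.exp (-x)) n
  rw [max_eq_right (by rw [abs_of_nonneg (by linarith), Real.abs_exp]; exact e1), Real.abs_exp,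
    abs_sub_comm (1 - x), abs_of_nonneg (a := Real.exp (-x) - (1 - x)) (by linarith),
    ← Real.exp_nat_mul, mul_neg] at e3
  refine e3.trans ?_
  rw [mul_comm (n : ℝ)]
  gcongr
  exact exp_neg_pred_mul_le hn h1

/-- The two bases differ by xy only; the mean value bound for n-th powers keeps the exponential
decay in both variables. -/
theorem abs_cov_le {n : ℕ} (hn : n ≠ 0) {x y : ℝ} (hx : 0 ≤ x) (hy : 0 ≤ y) (hxy : x + y ≤ 1) :
    |(1 - (x + y)) ^ n - (1 - x) ^ n * (1 - y) ^ n| ≤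
      n * (x * (Real.exp 1 * Real.exp (-(n * x)))) *
        (y * (Real.exp 1 * Real.exp (-(n * y)))) := by
  have e3 := abs_pow_sub_pow_le (1 - (x + y)) ((1 - x) * (1 - y)) n
  have h1 : 0 ≤ (1 - x) * (1 - y) := mul_nonneg (by linarith) (by linarith)
  rw [max_eq_right (by
      rw [abs_of_nonneg (by linarith), abs_of_nonneg h1]; nlinarith [mul_nonneg hx hy]),
    abs_of_nonneg h1, mul_pow, mul_pow,
    show 1 - (x + y) - (1 - x) * (1 - y) = -(x * y) by ring, abs_neg,
    abs_of_nonneg (mul_nonneg hx hy)] at e3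
  refine e3.trans ?_
  have b : ∀ z : ℝ, z ≤ 1 → (1 - z) ^ (n - 1) ≤ Real.exp 1 * Real.exp (-(n * z)) := fun z hz =>
    (pow_le_pow_left₀ (by linarith) (Real.one_sub_le_exp_neg z) _).trans
      (exp_neg_pred_mul_le hn hz)
  calc _ ≤ x * y * n * ((Real.exp 1 * Real.exp (-(n * x))) *
        (Real.exp 1 * Real.exp (-(n * y)))) := by
        gcongr
        · exact pow_nonneg (by linarith) _
        · exact b x (by linarith)
        · exact b y (by linarith)
    _ = _ := by ring

theorem pow_four_mul_exp_neg_le {z : ℝ} (hz : 0 ≤ z) :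
    z ^ 4 * Real.exp (-z) ≤ 64 * ((z / 2) ^ 2 * Real.exp (-(z / 2))) := by
  have e1 := mul_exp_neg_le_one (z / 4)
  have e2 : Real.exp (-z) = Real.exp (-(z / 4)) ^ 2 * Real.exp (-(z / 2)) := by
    rw [← Real.exp_nat_mul, ← Real.exp_add]; congr 1; push_cast; ring
  have e3 : (z / 4 * Real.exp (-(z / 4))) ^ 2 ≤ 1 := pow_le_one₀ (by positivity) e1
  calc z ^ 4 * Real.exp (-z) = 16 * (z ^ 2 * Real.exp (-(z / 2))) *
        (z / 4 * Real.exp (-(z / 4))) ^ 2 := by rw [e2]; ring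
    _ ≤ 16 * (z ^ 2 * Real.exp (-(z / 2))) * 1 := by gcongr
    _ = _ := by ring

/-- The F(n)² term bounds the covariances. The F(n/2) term bounds the change from (1 - p_j)^n to
exp(-n p_j) on the diagonal, where sums of (n p_j)⁴ exp(-n p_j) arise and half of the exponential
absorbs two powers. -/
theorem IsSample.abs_variance_missingMass_sub_le (h : IsSample p P U) {n : ℕ} (hn : n ≠ 0) :
    |(n : ℝ) ^ 2 * Var[missingMass p U n; P] - (quadExpSum p n - quadExpSum p (2 * n) / 4)| ≤
      (Real.exp 1 ^ 2 * quadExpSum p n ^ 2 + 64 * Real.exp 1 * quadExpSum p (n / 2)) / n := by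
  have n0 : (0 : ℝ) < n := by positivity
  have hp0 : ∀ j, 0 ≤ (p j).toReal := fun j => ENNReal.toReal_nonneg
  have hs : HasSum (fun j => (p j).toReal ^ 2 * (Real.exp 1 * Real.exp (-(n * (p j).toReal))))
      (Real.exp 1 * (quadExpSum p n / (n : ℝ) ^ 2)) :=
    ((hasSum_sq_mul_exp (p := p) n0).mul_left (Real.exp 1)).congr_fun fun j => by ring
  have e := abs_variance_tsum_indicator_sub_le (h.nullMeasurableSet_count n) hp0
    (summable_toReal p) (h.measureReal_count n) (K := n) n0.le
    (s := fun j => Real.exp 1 * Real.exp (-(n * (p j).toReal))) (fun j => by positivity)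
    hs.summable (fun i j hij => by
      have e := h.measureReal_biInter_count n {i, j}
      simp only [Finset.mem_insert, Finset.mem_singleton, Set.iInter_iInter_eq_or_left,
        Set.iInter_iInter_eq_left, Finset.sum_pair hij] at e
      rw [e]
      refine abs_cov_le hn (hp0 i) (hp0 j) ?_
      rw [← Finset.sum_pair (f := fun j => (p j).toReal) hij]
      exact sum_toReal_le_one p _)
  rw [hs.tsum_eq, ← missingMass_eq_tsum_indicator] at e
  have hV := hasSum_sq_mul_exp_sub_sq (p := p) n0
  have hq1 : ∀ j, 0 ≤ (1 - (p j).toReal) ^ n := fun j =>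
    pow_nonneg (by linarith [toReal_le_one p j]) n
  have hD : Summable fun j => (p j).toReal ^ 2 *
      ((1 - (p j).toReal) ^ n - ((1 - (p j).toReal) ^ n) ^ 2) := by
    refine Summable.of_nonneg_of_le (fun j => ?_) (fun j => ?_)
      (hasSum_sq_mul_exp (p := p) n0).summable
    · have : (1 - (p j).toReal) ^ n ≤ 1 :=
        pow_le_one₀ (by linarith [toReal_le_one p j]) (by linarith [hp0 j])
      exact mul_nonneg (sq_nonneg _) (by nlinarith [hq1 j])
    · gcongr
      nlinarith [one_sub_pow_le_exp p n j, sq_nonneg ((1 - (p j).toReal) ^ n)]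
  have hG : HasSum (fun j => 64 * Real.exp 1 / (n : ℝ) ^ 3 *
      ((n / 2 * (p j).toReal) ^ 2 * Real.exp (-(n / 2 * (p j).toReal))))
      (64 * Real.exp 1 / (n : ℝ) ^ 3 * quadExpSum p (n / 2)) :=
    (summable_quadExp p (by positivity)).hasSum.mul_left _
  have hDV := (hD.hasSum.sub hV).norm_le_of_bounded hG fun j => by
    have hx0 := hp0 j
    have hx1 := toReal_le_one p j
    have hqe := one_sub_pow_le_exp p n j
    have hq := hq1 j
    have hd := exp_neg_sub_one_sub_pow_le hn hx0 hx1
    have he1 : Real.exp (-(n * (p j).toReal)) ≤ 1 := by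
      rw [Real.exp_le_one_iff]; have := mul_nonneg n0.le hx0; linarith
    have h4 := pow_four_mul_exp_neg_le (mul_nonneg n0.le hx0)
    set x := (p j).toReal
    set q := (1 - x) ^ n
    set y := Real.exp (-(n * x))
    have hy : 0 < y := Real.exp_pos _
    have hqy : |(q - q ^ 2) - (y - y ^ 2)| ≤ |q - y| := by
      rw [show (q - q ^ 2) - (y - y ^ 2) = (q - y) * (1 - q - y) by ring, abs_mul]
      refine mul_le_of_le_one_right (abs_nonneg _) ?_
      rw [abs_le]; constructor <;> linarith
    rw [Real.norm_eq_abs, ← mul_sub, abs_mul, abs_of_nonneg (sq_nonneg x)]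
    calc _ ≤ x ^ 2 * (n * x ^ 2 * (Real.exp 1 * y)) := by
          gcongr; exact hqy.trans hd
      _ = Real.exp 1 / (n : ℝ) ^ 3 * ((n * x) ^ 4 * y) := by field_simp
      _ ≤ Real.exp 1 / (n : ℝ) ^ 3 *
          (64 * ((n * x / 2) ^ 2 * Real.exp (-(n * x / 2)))) := by gcongr
      _ = _ := by rw [show n * x / 2 = n / 2 * x by ring]; ring
  rw [Real.norm_eq_abs] at hDV
  have htri := (abs_sub_le _ _ _).trans (add_le_add e hDV)
  have n2 : (0 : ℝ) < (n : ℝ) ^ 2 := by positivity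
  calc _ = (n : ℝ) ^ 2 * |Var[missingMass p U n; P] -
        (quadExpSum p n - quadExpSum p (2 * n) / 4) / (n : ℝ) ^ 2| := by
        rw [← abs_of_pos n2, ← abs_mul, abs_of_pos n2]
        congr 1; field_simp
    _ ≤ (n : ℝ) ^ 2 * _ := mul_le_mul_of_nonneg_left htri n2.le
    _ = _ := by field_simp

end Variance

/-! ### Passage to the limit -/

section Limits

variable {p : PMF ℕ} {a : ℝ → ℝ}

theorem tendsto_quadExpSum_sub_div
    (h : ExtendedSlowVariation (fun x : ℝ => counting p (1 / x)) a)
    (ha : Tendsto a atTop atTop) :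
    Tendsto (fun t => (quadExpSum p t - quadExpSum p (2 * t) / 4) / a t) atTop (𝓝 (3 / 4)) := by
  have e := (tendsto_quadExpSum_div h ha).sub ((tendsto_quadExpSum_two_mul_div h ha).div_const 4)
  rw [show (1 : ℝ) - 1 / 4 = 3 / 4 by norm_num] at e
  exact e.congr fun t => by ring

/-- F² / (t a) is the product of F/t, which tends to 0, and F/a, which tends to 1. -/
theorem tendsto_error_div
    (h : ExtendedSlowVariation (fun x : ℝ => counting p (1 / x)) a)
    (ha : Tendsto a atTop atTop) (A B : ℝ) :
    Tendsto (fun t => (A * quadExpSum p t ^ 2 + B * quadExpSum p (t / 2)) / t / a t) atTop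
      (𝓝 0) := by
  have e := (((tendsto_quadExpSum_div_self p).mul (tendsto_quadExpSum_div h ha)).const_mul A).add
    ((tendsto_inv_atTop_zero.mul (tendsto_quadExpSum_half_div h ha)).const_mul B)
  simp only [mul_one, mul_zero, add_zero] at e
  exact e.congr fun t => by ring

theorem isEquivalent_and_isTheta_of_tendsto {ι : Type*} {l : Filter ι} {τ V : ι → ℝ}
    (hV : Tendsto (fun i => τ i ^ 2 * V i / a (τ i)) l (𝓝 (3 / 4))) :
    (V ~[l] fun i => 3 * a (τ i) / (4 * τ i ^ 2)) ∧
      (fun i => 12 * a (τ i) / τ i ^ 2) =Θ[l] V := by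
  have key : V ~[l] fun i => 3 * a (τ i) / (4 * τ i ^ 2) := by
    refine isEquivalent_of_tendsto_one ?_
    have e := hV.const_mul (4 / 3)
    rw [show (4 / 3 : ℝ) * (3 / 4) = 1 by norm_num] at e
    refine e.congr fun i => ?_
    rw [Pi.div_apply, div_div_eq_mul_div]
    ring
  refine ⟨key, ?_⟩
  have e : (fun i => 12 * a (τ i) / τ i ^ 2) = fun i => 16 * (3 * a (τ i) / (4 * τ i ^ 2)) := by
    ext i; ring
  rw [e]
  exact (isTheta_const_mul_left (by norm_num)).2 key.symm.isTheta

end Limits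

end InfiniteUrn

/-! ### The main theorem -/

theorem mainTheorem5 (p : PMF ℕ) (a : ℝ → ℝ)
    (hℓ : InfiniteUrn.ExtendedSlowVariation (fun x : ℝ => InfiniteUrn.counting p (1 / x)) a)
    (ha : Tendsto a atTop atTop) :
    (∃ n₀ : ℕ, ∀ (Ω : Type*) [MeasurableSpace Ω] (P : Measure Ω) [IsProbabilityMeasure P]
        (U : ℕ → Ω → ℕ), InfiniteUrn.IsSample p P U →
      ((fun n : ℕ => Var[InfiniteUrn.missingMass p U n; P])
          ~[atTop] fun n : ℕ => 3 * a n / (4 * (n : ℝ) ^ 2)) ∧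
      ((fun n : ℕ => 12 * a n / (n : ℝ) ^ 2)
          =Θ[atTop] fun n : ℕ => Var[InfiniteUrn.missingMass p U n; P]) ∧
      (∀ n : ℕ, n₀ < n → ∀ lam : ℝ, 0 < lam → lam < n →
        InfiniteUrn.centredLogLaplace P (InfiniteUrn.missingMass p U n) lam
          ≤ (12 * a n / (n : ℝ) ^ 2) * lam ^ 2 / (2 * (1 - lam / n)))) ∧
    (∃ t₀ : ℝ≥0, ∀ (Ω : Type*) [MeasurableSpace Ω] (P : Measure Ω) [IsProbabilityMeasure P]
        (U : ℕ → Ω → ℕ) (N : ℝ≥0 → Ω → ℕ), InfiniteUrn.IsPoissonSample p P U N →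
      ((fun t : ℝ≥0 => Var[InfiniteUrn.poissonMissingMass p U N t; P])
          ~[atTop] fun t : ℝ≥0 => 3 * a t / (4 * (t : ℝ) ^ 2)) ∧
      ((fun t : ℝ≥0 => 12 * a t / (t : ℝ) ^ 2)
          =Θ[atTop] fun t : ℝ≥0 => Var[InfiniteUrn.poissonMissingMass p U N t; P]) ∧
      (∀ t : ℝ≥0, t₀ < t → ∀ lam : ℝ, 0 < lam → lam < t →
        InfiniteUrn.centredLogLaplace P (InfiniteUrn.poissonMissingMass p U N t) lam
          ≤ (12 * a t / (t : ℝ) ^ 2) * lam ^ 2 / (2 * (1 - lam / t)))) := by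
  obtain ⟨T, T0, hT⟩ := InfiniteUrn.exists_sum_exp_sub_le hℓ ha
  have hmain := InfiniteUrn.tendsto_quadExpSum_sub_div hℓ ha
  -- T is obtained before any probability space is introduced, so both thresholds depend on p and a
  -- alone.
  refine ⟨⟨⌈T⌉₊, fun Ω _ P _ U hU => ?_⟩, ⟨⟨T, T0.le⟩, fun Ω _ P _ U N hU => ?_⟩⟩
  · have hlim : Tendsto (fun n : ℕ => (n : ℝ) ^ 2 * Var[InfiniteUrn.missingMass p U n; P] / a n)
        atTop (𝓝 (3 / 4)) := by
      have herr := (InfiniteUrn.tendsto_error_div hℓ ha (Real.exp 1 ^ 2)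
        (64 * Real.exp 1)).comp (tendsto_natCast_atTop_atTop (R := ℝ))
      have hdiff : Tendsto (fun n : ℕ => (n : ℝ) ^ 2 * Var[InfiniteUrn.missingMass p U n; P] / a n -
          (InfiniteUrn.quadExpSum p n - InfiniteUrn.quadExpSum p (2 * n) / 4) / a n)
          atTop (𝓝 0) := by
        refine squeeze_zero_norm' ?_ herr
        filter_upwards [eventually_ne_atTop 0,
          tendsto_natCast_atTop_atTop.eventually (ha.eventually_gt_atTop 0)] with n hn han
        rw [← sub_div, Real.norm_eq_abs, abs_div, abs_of_pos han]
        exact div_le_div_of_nonneg_right (hU.abs_variance_missingMass_sub_le hn) han.le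
      have e := hdiff.add (hmain.comp tendsto_natCast_atTop_atTop)
      rw [zero_add] at e
      exact e.congr fun n => sub_add_cancel _ _
    obtain ⟨h1, h2⟩ := InfiniteUrn.isEquivalent_and_isTheta_of_tendsto hlim
    refine ⟨h1, h2, fun n hn lam hl hln => ?_⟩
    exact hU.centredLogLaplace_missingMass_le hl
      ((hT n ((Nat.le_ceil T).trans (Nat.cast_le.2 hn.le))).2 lam hl hln)
  · have hlim : Tendsto (fun t : ℝ≥0 => (t : ℝ) ^ 2 *
        Var[InfiniteUrn.poissonMissingMass p U N t; P] / a t) atTop (𝓝 (3 / 4)) := by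
      refine (hmain.comp (NNReal.tendsto_coe_atTop.2 tendsto_id)).congr' ?_
      filter_upwards [eventually_gt_atTop 0] with t ht
      have t0 : (t : ℝ) ≠ 0 := (NNReal.coe_pos.2 ht).ne'
      rw [hU.variance_missingMass ht, mul_div_cancel₀ _ (pow_ne_zero 2 t0)]
      rfl
    obtain ⟨h1, h2⟩ := InfiniteUrn.isEquivalent_and_isTheta_of_tendsto hlim
    refine ⟨h1, h2, fun t ht lam hl hlt => ?_⟩
    exact hU.centredLogLaplace_missingMass_le hl ((hT t ht.le).2 lam hl hlt)
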